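/- Let $f\colon X\to S$ be a differentially smooth morphism of schemes: $\Omega^1_{X/S}$ is locally free of finite rank and the canonical map $\operatorname{Sym}_{\mathcal O_X}(\Omega^1_{X/S})\to\bigoplus_{n\ge 0}\mathcal I^n/\mathcal I^{n+1}$ is an isomorphism, where $\mathcal I$ is the ideal sheaf of the diagonal $X\to X\times_S X$ (in an open subscheme of $X\times_S X$ in which the diagonal is closed). Let $\mathcal E$ be a locally free $\mathcal O_X$-module of finite rank and let $k\ge 1$ be an integer. Let $X^{(k)}$ be the $k$-th infinitesimal neighbourhood of the diagonal, that is, the closed subscheme defined by $\mathcal I^{k+1}$, with its two projections $p,q\colon X^{(k)}\to X$, which coincide on the underlying topological spaces. Let $\mathcal J^k(\mathcal E)$ be the sheaf of principal parts of $\mathcal E$, with its left and its right $\mathcal O_X$-module structure: $$\mathcal J^k(\mathcal E)^{left}=p_*q^*\mathcal E,\qquad \mathcal J^k(\mathcal E)^{right}=q_*q^*\mathcal E .$$ Then $\mathcal J^k(\mathcal E)^{left}$ and $\mathcal J^k(\mathcal E)^{right}$ are locally free $\mathcal O_X$-modules of finite rank, and $$[\mathcal J^k(\mathcal E)^{left}]=[\mathcal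 J^k(\mathcal E)^{right}]$$ in the Grothendieck group $K(X)$ of locally free $\mathcal O_X$-modules of finite rank, i.e. the free abelian group on these modules modulo the relations $[\mathcal M]=[\mathcal M']+[\mathcal M'']$ for all short exact sequences $0\to\mathcal M'\to\mathcal M\to\mathcal M''\to 0$ of such modules. -/

import Mathlib

open CategoryTheory AlgebraicGeometry
open scoped TensorProduct

universe u

noncomputable section

/-! ### Differentially smooth morphisms -/

section Ring

/-- The associated graded ring `⨁ₙ Iⁿ / Iⁿ⁺¹` of an ideal `I` of `B`: the quotient of the Rees algebra
`⨁ₙ Iⁿ tⁿ` by the ideal generated by `I` in degree zero. -/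
def GradedOfIdeal {B : Type u} [CommRing B] (I : Ideal B) : Type u :=
  reesAlgebra I ⧸ I.map (algebraMap B (reesAlgebra I))

instance {B : Type u} [CommRing B] (I : Ideal B) : CommRing (GradedOfIdeal I) :=
  inferInstanceAs (CommRing (reesAlgebra I ⧸ I.map (algebraMap B (reesAlgebra I))))

instance {A B : Type u} [CommRing A] [CommRing B] [Algebra A B] (I : Ideal B) :
    Algebra A (GradedOfIdeal I) :=
  inferInstanceAs (Algebra A (reesAlgebra I ⧸ I.map (algebraMap B (reesAlgebra I))))

instance {A B : Type u} [CommRing A] [CommRing B] [Algebra A B] (I : Ideal B) :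
    IsScalarTower A B (GradedOfIdeal I) :=
  inferInstanceAs (IsScalarTower A B (reesAlgebra I ⧸ I.map (algebraMap B (reesAlgebra I))))

/-- The map `I → ⨁ₙ Iⁿ / Iⁿ⁺¹` sending `x` to the class of `x t`, of degree one. -/
def idealToGraded {B : Type u} [CommRing B] (I : Ideal B) : I →ₗ[B] GradedOfIdeal I :=
  (Ideal.Quotient.mkₐ B (I.map (algebraMap B (reesAlgebra I)))).toLinearMap.comp
    (LinearMap.codRestrict (Subalgebra.toSubmodule (reesAlgebra I))
      ((Polynomial.monomial 1).comp I.subtype)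
      fun x => reesAlgebra.monomial_mem.2 (by simp))

theorem smul_top_le_ker_idealToGraded {B : Type u} [CommRing B] (I : Ideal B) :
    I • (⊤ : Submodule B I) ≤ LinearMap.ker (idealToGraded I) := by
  rw [Submodule.smul_le]
  rintro r hr n -
  rw [LinearMap.mem_ker, LinearMap.map_smul, Algebra.smul_def]
  have : algebraMap B (GradedOfIdeal I) r = 0 :=
    Ideal.Quotient.eq_zero_iff_mem.2 (Ideal.mem_map_of_mem _ hr)
  rw [this, zero_mul]

variable (R A : Type u) [CommRing R] [CommRing A] [Algebra R A]

/-- The canonical map from `Ω_{A/R} = I / I²` to the degree one part of `⨁ₙ Iⁿ / Iⁿ⁺¹`, where `I` is the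
kernel of the multiplication `A ⊗[R] A → A`.  It is linear over `A`, acting through the left factor. -/
def kaehlerToGraded :
    Ω[A⁄R] →ₗ[A] GradedOfIdeal (KaehlerDifferential.ideal R A) :=
  LinearMap.restrictScalars (S := A ⊗[R] A) A
    (show Ω[A⁄R] →ₗ[A ⊗[R] A] GradedOfIdeal (KaehlerDifferential.ideal R A) from
      Submodule.liftQ _ (idealToGraded (KaehlerDifferential.ideal R A))
        (smul_top_le_ker_idealToGraded _))

/-- `A` is differentially smooth over `R`: the module `Ω_{A/R} = I / I²` is finite projective and
the canonical map `Sym_A (I / I²) → ⨁ₙ Iⁿ / Iⁿ⁺¹` is bijective. -/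
structure IsDifferentiallySmoothAlgebra : Prop where
  finite : Module.Finite A Ω[A⁄R]
  projective : Module.Projective A Ω[A⁄R]
  bijective : IsSymmetricAlgebra (kaehlerToGraded R A)

end Ring

/-- A morphism of schemes `f : X ⟶ S` is differentially smooth if `Ω¹_{X/S}` is locally free of finite
rank and `Sym Ω¹_{X/S} → ⨁ₙ Iⁿ / Iⁿ⁺¹` is an isomorphism, where `I` is the ideal of the diagonal.
Both conditions are local on `X`, and are expressed here on affine charts. -/
def IsDifferentiallySmooth {X S : Scheme.{u}} (f : X ⟶ S) : Prop :=
  ∀ x : X, ∃ (V : S.Opens) (U : X.Opens) (e : U ≤ f ⁻¹ᵁ V),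
    IsAffineOpen V ∧ IsAffineOpen U ∧ x ∈ U ∧
      letI := (f.appLE V U e).hom.toAlgebra
      IsDifferentiallySmoothAlgebra Γ(S, V) Γ(X, U)

/-! ### Locally free sheaves of finite rank and their Grothendieck group -/

/-- Every point has an open neighbourhood `U` with `M|_U ≅ 𝒪_U ^ n` for some natural number `n`. -/
def IsLocallyFreeOfFiniteRank {X : Scheme.{u}} (M : X.Modules) : Prop :=
  ∀ x : X, ∃ (U : X.Opens) (n : ℕ), x ∈ U ∧
    Nonempty (M.restrict U.ι ≅
      (SheafOfModules.free (ULift.{u} (Fin n)) : SheafOfModules U.toScheme.ringCatSheaf))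

/-- Locally free `𝒪_X`-modules of finite rank. -/
abbrev FiniteLocallyFree (X : Scheme.{u}) : Type (u + 1) :=
  { M : X.Modules // IsLocallyFreeOfFiniteRank M }

/-- The elements `[M] - [M'] - [M'']` for the short exact sequences `0 → M' → M → M'' → 0` of locally
free `𝒪_X`-modules of finite rank. -/
def exactSequenceRelations (X : Scheme.{u}) : Set (FreeAbelianGroup (FiniteLocallyFree X)) :=
  { r | ∃ (T : ShortComplex X.Modules) (_ : T.ShortExact)
      (h₁ : IsLocallyFreeOfFiniteRank T.X₁) (h₂ : IsLocallyFreeOfFiniteRank T.X₂)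
      (h₃ : IsLocallyFreeOfFiniteRank T.X₃),
      r = FreeAbelianGroup.of ⟨T.X₂, h₂⟩ - FreeAbelianGroup.of ⟨T.X₁, h₁⟩ -
        FreeAbelianGroup.of ⟨T.X₃, h₃⟩ }

/-- The Grothendieck group `K(X)` of locally free `𝒪_X`-modules of finite rank. -/
abbrev KGroup (X : Scheme.{u}) : Type (u + 1) :=
  FreeAbelianGroup (FiniteLocallyFree X) ⧸ AddSubgroup.closure (exactSequenceRelations X)

/-- The class `[M]` in `K(X)` of a locally free `𝒪_X`-module `M` of finite rank. -/
def KGroup.mk {X : Scheme.{u}} (M : X.Modules) (hM : IsLocallyFreeOfFiniteRank M) : KGroup X :=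
  QuotientAddGroup.mk (FreeAbelianGroup.of ⟨M, hM⟩)

/-! ### Sheaves of principal parts -/

section PrincipalParts

variable {X S : Scheme.{u}} (f : X ⟶ S) (k : ℕ)

/-- The `k`-th infinitesimal neighbourhood of the diagonal of `X ×_S X`: the diagonal is closed in the
open subscheme `coborderRange` of `X ×_S X` (which is everything if `X / S` is separated), with ideal
sheaf `I` there, and the neighbourhood is the closed subscheme defined by `Iᵏ⁺¹`. -/
def infinitesimalNbhd : Scheme.{u} :=
  ((Limits.pullback.diagonal f).liftCoborder.ker ^ (k + 1)).subscheme

/-- The immersion of the `k`-th infinitesimal neighbourhood of the diagonal into `X ×_S X`. -/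
def infinitesimalNbhd.ι : infinitesimalNbhd f k ⟶ Limits.pullback f f :=
  ((Limits.pullback.diagonal f).liftCoborder.ker ^ (k + 1)).subschemeι ≫
    (Limits.pullback.diagonal f).coborderRange.ι

/-- The first projection to `X`. -/
def infinitesimalNbhd.fst : infinitesimalNbhd f k ⟶ X :=
  infinitesimalNbhd.ι f k ≫ Limits.pullback.fst f f

/-- The second projection to `X`. -/
def infinitesimalNbhd.snd : infinitesimalNbhd f k ⟶ X :=
  infinitesimalNbhd.ι f k ≫ Limits.pullback.snd f f

/-- The two projections of the infinitesimal neighbourhood coincide on points, so that direct images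
along them have the same underlying sheaf of abelian groups. -/
theorem infinitesimalNbhd.fst_apply_eq_snd_apply (z : infinitesimalNbhd f k) :
    infinitesimalNbhd.fst f k z = infinitesimalNbhd.snd f k z := by
  set d := Limits.pullback.diagonal f
  have hz : (d.liftCoborder.ker ^ (k + 1)).subschemeι z ∈ Set.range d.liftCoborder := by
    have h1 : (d.liftCoborder.ker ^ (k + 1)).subschemeι z ∈
        Set.range (d.liftCoborder.ker ^ (k + 1)).subschemeι := ⟨z, rfl⟩
    rw [Scheme.IdealSheafData.range_subschemeι,
      Scheme.IdealSheafData.support_pow _ _ (Nat.succ_ne_zero k), Scheme.Hom.support_ker] at h1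
    rwa [d.liftCoborder.isClosedEmbedding.isClosed_range.closure_eq] at h1
  obtain ⟨x, hx⟩ := hz
  have hι : infinitesimalNbhd.ι f k z = d x := by
    refine (Scheme.Hom.comp_apply (d.liftCoborder.ker ^ (k + 1)).subschemeι d.coborderRange.ι z).trans ?_
    rw [← hx, ← Scheme.Hom.comp_apply, Scheme.Hom.liftCoborder_ι]
  rw [infinitesimalNbhd.fst, infinitesimalNbhd.snd,Scheme.Hom.comp_apply, Scheme.Hom.comp_apply, hι, ← Scheme.Hom.comp_apply,
    ← Scheme.Hom.comp_apply, Limits.pullback.diagonal_fst, Limits.pullback.diagonal_snd]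

/-- `Jᵏ(E)` with its left `𝒪_X`-module structure, `p_* q^* E` for the projections `p`, `q` of the `k`-th
infinitesimal neighbourhood of the diagonal. -/
def jetLeft (E : X.Modules) : X.Modules :=
  (Scheme.Modules.pushforward (infinitesimalNbhd.fst f k)).obj
    ((Scheme.Modules.pullback (infinitesimalNbhd.snd f k)).obj E)

/-- `Jᵏ(E)` with its right `𝒪_X`-module structure: the same sheaf of abelian groups as `jetLeft`, on
which `𝒪_X` acts through the second projection `q` instead of the first. -/
def jetRight (E : X.Modules) : X.Modules :=
  (Scheme.Modules.pushforward (infinitesimalNbhd.snd f k)).obj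
    ((Scheme.Modules.pullback (infinitesimalNbhd.snd f k)).obj E)

end PrincipalParts

end

/-!
Write `p` and `q` for the two projections of the `k`-th infinitesimal neighbourhood of the diagonal.
On an affine chart, `⨁ Iⁿ / Iⁿ⁺¹` is the symmetric algebra of a finite projective module, hence each
`Iⁿ / Iⁿ⁺¹` is finite projective and so is the ring of functions on the neighbourhood, over either
projection. This makes `p` and `q` finite locally free, and `Jᵏ(E)` locally free of finite rank for
both of its structures.

The kernel of the surjection `Jᵏ⁺¹(E) → Jᵏ(E)` is killed by `I`, which contains the differences
`p^♯ a - q^♯ a`. On this kernel the left and the right `𝒪_X`-module structures therefore agree, and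
additivity of classes in `K(X)` reduces the equality for `k + 1` to the one for `k`, down to the
diagonal itself, where `p = q`.
-/

noncomputable section

open Scheme

/-! ### The associated graded ring and quotients by powers of an ideal -/

section ExactSequences

variable {A M N P : Type*} [CommRing A] [AddCommGroup M] [Module A M] [AddCommGroup N] [Module A N]
  [AddCommGroup P] [Module A P] [Module.Projective A P]

theorem nonempty_linearEquiv_prod_of_exact {i : M →ₗ[A] N} {q : N →ₗ[A] P}
    (hi : Function.Injective i) (hiq : Function.Exact i q) (hq : Function.Surjective q) :
    Nonempty (N ≃ₗ[A] M × P) := by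
  obtain ⟨s, hs⟩ := Module.projective_lifting_property q LinearMap.id hq
  obtain ⟨e, -⟩ := (hiq.split_tfae'.out 0 2).1
    (show Function.Injective i ∧ ∃ s, q ∘ₗ s = LinearMap.id from ⟨hi, s, hs⟩)
  exact ⟨e⟩

end ExactSequences

section GradedPieces

variable {B : Type u} [CommRing B] (I : Ideal B)

/-- The graded piece `Iⁿ / Iⁿ⁺¹` of the associated graded ring of `I`. -/
abbrev GradedPiece (n : ℕ) : Type u :=
  ↥(I ^ n) ⧸ (I • ⊤ : Submodule B ↥(I ^ n))

namespace GradedPiece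

variable (n : ℕ)

/-- The map `Iⁿ → ⨁ₙ Iⁿ / Iⁿ⁺¹` sending `x` to the class of `x tⁿ`. -/
def ofPow : ↥(I ^ n) →ₗ[B] GradedOfIdeal I :=
  (Ideal.Quotient.mkₐ B (I.map (algebraMap B (reesAlgebra I)))).toLinearMap.comp
    (LinearMap.codRestrict (Subalgebra.toSubmodule (reesAlgebra I))
      ((Polynomial.monomial n).comp (I ^ n).subtype)
      fun x => reesAlgebra.monomial_mem.2 x.2)

theorem smul_top_le_ker_ofPow : I • (⊤ : Submodule B ↥(I ^ n)) ≤ LinearMap.ker (ofPow I n) := by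
  rw [Submodule.smul_le]
  rintro r hr x -
  have hr0 : algebraMap B (GradedOfIdeal I) r = 0 :=
    Ideal.Quotient.eq_zero_iff_mem.2 (Ideal.mem_map_of_mem _ hr)
  rw [LinearMap.mem_ker, LinearMap.map_smul, Algebra.smul_def, hr0, zero_mul]

/-- The inclusion of a graded piece into the associated graded ring. -/
def incl : GradedPiece I n →ₗ[B] GradedOfIdeal I :=
  Submodule.liftQ _ (ofPow I n) (smul_top_le_ker_ofPow I n)

/-- The coefficient of `tⁿ` in the Rees algebra, as a class in `Iⁿ / Iⁿ⁺¹`. -/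
def coeff : reesAlgebra I →ₗ[B] GradedPiece I n :=
  (Submodule.mkQ _).comp
    (LinearMap.codRestrict (I ^ n)
      ((Polynomial.lcoeff B n).comp (Subalgebra.toSubmodule (reesAlgebra I)).subtype)
      fun x => x.2 n)

/-- The projection of the associated graded ring to a graded piece. -/
def proj : GradedOfIdeal I →ₗ[B] GradedPiece I n :=
  Submodule.liftQ ((I.map (algebraMap B (reesAlgebra I))).restrictScalars B) (coeff I n) (by
    rw [← Ideal.smul_top_eq_map, Submodule.smul_le]
    rintro r hr x -
    rw [LinearMap.mem_ker, LinearMap.map_smul]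
    exact (Submodule.Quotient.mk_eq_zero _).2 (Submodule.smul_mem_smul hr trivial))

theorem proj_comp_incl : (proj I n).comp (incl I n) = LinearMap.id := by
  apply Submodule.linearMap_qext
  ext x : 1
  exact congrArg (Submodule.mkQ _) (Subtype.ext (Polynomial.coeff_monomial_same n _))

theorem projective (A : Type u) [CommRing A] [Algebra A B] [Module.Projective A (GradedOfIdeal I)] :
    Module.Projective A (GradedPiece I n) :=
  Module.Projective.of_split ((incl I n).restrictScalars A) ((proj I n).restrictScalars A)
    (LinearMap.ext fun x => LinearMap.congr_fun (proj_comp_incl I n) x)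

theorem map_subtype_smul_top :
    (I • ⊤ : Submodule B ↥(I ^ n)).map (I ^ n).subtype = I ^ (n + 1) := by
  rw [Submodule.map_smul'', Submodule.map_top, Submodule.range_subtype, smul_eq_mul, ← pow_succ']

/-- The map `Iⁿ / Iⁿ⁺¹ → B / Iⁿ⁺¹`. -/
def toQuotient : GradedPiece I n →ₗ[B] B ⧸ I ^ (n + 1) :=
  Submodule.liftQ _ ((Submodule.mkQ (I ^ (n + 1))).comp (I ^ n).subtype) (by
    rw [LinearMap.ker_comp, Submodule.ker_mkQ, ← Submodule.map_le_iff_le_comap,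
      map_subtype_smul_top])

theorem toQuotient_injective : Function.Injective (toQuotient I n) := by
  rw [← LinearMap.ker_eq_bot, toQuotient]
  refine Submodule.ker_liftQ_eq_bot' _ _ ?_
  rw [LinearMap.ker_comp, Submodule.ker_mkQ, ← map_subtype_smul_top,
    Submodule.comap_map_eq_of_injective (I ^ n).injective_subtype]

theorem exact_toQuotient_factor : Function.Exact (toQuotient I n)
    (Submodule.factor (Ideal.pow_le_pow_right n.le_succ : I ^ (n + 1) ≤ I ^ n)) := by
  intro y
  obtain ⟨b, rfl⟩ := Submodule.Quotient.mk_surjective _ y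
  constructor
  · intro hb
    exact ⟨Submodule.Quotient.mk ⟨b, (Submodule.Quotient.mk_eq_zero _).1 hb⟩, rfl⟩
  · rintro ⟨x, hx⟩
    obtain ⟨x, rfl⟩ := Submodule.Quotient.mk_surjective _ x
    rw [← hx]
    exact (Submodule.Quotient.mk_eq_zero _).2 x.2

end GradedPiece

theorem exists_fg_le_and_le_sup_sq [Module.Finite B I.Cotangent] :
    ∃ J : Ideal B, J.FG ∧ J ≤ I ∧ I ≤ J ⊔ I ^ 2 := by
  obtain ⟨s, hs⟩ := Module.finite_def.1 ‹Module.Finite B I.Cotangent›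
  choose lift hlift using I.toCotangent_surjective
  let N : Submodule B I := Submodule.span B (lift '' s)
  have hN : N.map I.toCotangent = ⊤ := by
    rw [Submodule.map_span, Set.image_image]
    simp only [hlift, Set.image_id', hs]
  refine ⟨N.map I.subtype, (Submodule.fg_span (s.finite_toSet.image lift)).map _,
    Submodule.map_subtype_le I N, fun a ha => ?_⟩
  obtain ⟨b, hb, hba⟩ : I.toCotangent ⟨a, ha⟩ ∈ N.map I.toCotangent := hN ▸ trivial
  rw [I.toCotangent_eq] at hba
  rw [← sub_sub_cancel (b : B) a]
  exact sub_mem (Ideal.mem_sup_left (Submodule.mem_map_of_mem hb)) (Ideal.mem_sup_right hba)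

theorem pow_le_sup_pow_succ {I J : Ideal B} (hJI : J ≤ I) (hIJ : I ≤ J ⊔ I ^ 2) (n : ℕ) :
    I ^ n ≤ J ^ n ⊔ I ^ (n + 1) := by
  induction n with
  | zero => simp only [pow_zero, Ideal.one_eq_top, le_sup_left]
  | succ n ih =>
    calc I ^ (n + 1) = I ^ n * I := pow_succ _ _
      _ ≤ (J ^ n ⊔ I ^ (n + 1)) * (J ⊔ I ^ 2) := Ideal.mul_mono ih hIJ
      _ = J ^ n * J ⊔ I ^ (n + 1) * J ⊔ (J ^ n * I ^ 2 ⊔ I ^ (n + 1) * I ^ 2) := by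
        rw [Ideal.mul_sup, Ideal.sup_mul, Ideal.sup_mul]
      _ ≤ J ^ (n + 1) ⊔ I ^ (n + 2) := by
        refine sup_le (sup_le ?_ ?_) (sup_le ?_ ?_)
        · exact le_sup_of_le_left (pow_succ J n).ge
        · exact le_sup_of_le_right ((Ideal.mul_mono_right hJI).trans (pow_succ I (n + 1)).ge)
        · exact le_sup_of_le_right
            ((Ideal.mul_mono_left (Ideal.pow_right_mono hJI n)).trans (pow_add I n 2).ge)
        · exact le_sup_of_le_right ((pow_add I (n + 1) 2).ge.trans
            (Ideal.pow_le_pow_right (by omega)))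

theorem GradedPiece.finite [Module.Finite B I.Cotangent] (n : ℕ) :
    Module.Finite B (GradedPiece I n) := by
  obtain ⟨J, hJ, hJI, hIJ⟩ := exists_fg_le_and_le_sup_sq I
  have : Module.Finite B ↥(J ^ n) := Module.Finite.iff_fg.2 hJ.pow
  refine Module.Finite.of_surjective
    ((Submodule.mkQ _).comp (Submodule.inclusion (Ideal.pow_right_mono hJI n)) :
      ↥(J ^ n) →ₗ[B] GradedPiece I n) fun y => ?_
  obtain ⟨⟨y, hy⟩, rfl⟩ := Submodule.Quotient.mk_surjective _ y
  obtain ⟨a, ha, b, hb, hab⟩ := Submodule.mem_sup.1 (pow_le_sup_pow_succ hJI hIJ n hy)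
  rw [← map_subtype_smul_top] at hb
  obtain ⟨c, hc, rfl⟩ := hb
  refine ⟨⟨a, ha⟩, (Submodule.Quotient.eq' _).2 ?_⟩
  rwa [show -Submodule.inclusion (Ideal.pow_right_mono hJI n) ⟨a, ha⟩ + ⟨y, hy⟩ = c from
    Subtype.ext (neg_add_eq_of_eq_add hab.symm)]

section Algebra

variable {A : Type u} [CommRing A] [Algebra A B]

theorem GradedPiece.finite_of_surjective [Module.Finite B I.Cotangent]
    (hAI : Function.Surjective (algebraMap A (B ⧸ I))) (n : ℕ) :
    Module.Finite A (GradedPiece I n) := by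
  have := GradedPiece.finite I n
  have : Module.Finite A (B ⧸ I) := Module.Finite.of_surjective (Algebra.linearMap A _) hAI
  have : Module.Finite (B ⧸ I) (GradedPiece I n) := .of_restrictScalars_finite B _ _
  have : IsScalarTower A (B ⧸ I) (GradedPiece I n) := .to₁₃₄ A B (B ⧸ I) (GradedPiece I n)
  exact .trans (B ⧸ I) _

theorem finite_projective_quotient_pow
    (hI : ∀ n, Module.Finite A (GradedPiece I n) ∧ Module.Projective A (GradedPiece I n)) (n : ℕ) :
    Module.Finite A (B ⧸ I ^ n) ∧ Module.Projective A (B ⧸ I ^ n) := by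
  induction n with
  | zero =>
    have : Subsingleton (B ⧸ I ^ 0) :=
      Ideal.Quotient.subsingleton_iff.2 (by rw [pow_zero, Ideal.one_eq_top])
    exact ⟨inferInstance, inferInstance⟩
  | succ n ih =>
    obtain ⟨_, _⟩ := ih
    obtain ⟨_, _⟩ := hI n
    let q : B ⧸ I ^ (n + 1) →ₗ[B] B ⧸ I ^ n := Submodule.factor (Ideal.pow_le_pow_right n.le_succ)
    have hq : Function.Surjective q := Submodule.factor_surjective _
    obtain ⟨e⟩ := nonempty_linearEquiv_prod_of_exact
      (i := (GradedPiece.toQuotient I n).restrictScalars A) (q := q.restrictScalars A)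
      (GradedPiece.toQuotient_injective I n) (GradedPiece.exact_toQuotient_factor I n) hq
    exact ⟨.equiv e.symm, .of_equiv' e.symm⟩

end Algebra

end GradedPieces

section DifferentiallySmooth

theorem projective_symmetricAlgebra (R M : Type*) [CommRing R] [AddCommGroup M] [Module R M]
    [Module.Projective R M] : Module.Projective R (SymmetricAlgebra R M) := by
  obtain ⟨s, hs⟩ := Module.projective_def'.1 (inferInstance : Module.Projective R M)
  let p : (M →₀ R) →ₗ[R] M := Finsupp.linearCombination R id
  let i : SymmetricAlgebra R M →ₐ[R] SymmetricAlgebra R (M →₀ R) :=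
    SymmetricAlgebra.lift ((SymmetricAlgebra.ι R _).comp s)
  let r : SymmetricAlgebra R (M →₀ R) →ₐ[R] SymmetricAlgebra R M :=
    SymmetricAlgebra.lift ((SymmetricAlgebra.ι R _).comp p)
  have hri : r.comp i = AlgHom.id R _ := by
    apply SymmetricAlgebra.algHom_ext
    ext m
    have hm : p (s m) = m := LinearMap.congr_fun hs m
    simp [i, r, hm]
  exact Module.Projective.of_split i.toLinearMap r.toLinearMap
    (LinearMap.ext (AlgHom.congr_fun hri))

theorem IsDifferentiallySmoothAlgebra.finite_projective_quotient_pow {R A : Type u} [CommRing R]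
    [CommRing A] [Algebra R A] (h : IsDifferentiallySmoothAlgebra R A) (n : ℕ) :
    Module.Finite A (A ⊗[R] A ⧸ KaehlerDifferential.ideal R A ^ n) ∧
      Module.Projective A (A ⊗[R] A ⧸ KaehlerDifferential.ideal R A ^ n) := by
  set I := KaehlerDifferential.ideal R A
  have : Module.Finite A I.Cotangent := h.finite
  have : Module.Finite (A ⊗[R] A) I.Cotangent := .of_restrictScalars_finite A _ _
  have : Module.Projective A Ω[A⁄R] := h.projective
  have := projective_symmetricAlgebra A Ω[A⁄R]
  have : Module.Projective A (GradedOfIdeal I) := .of_equiv' h.bijective.equiv.toLinearEquiv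
  have hAI : Function.Surjective (algebraMap A (A ⊗[R] A ⧸ I)) := fun b => by
    obtain ⟨b, rfl⟩ := Ideal.Quotient.mk_surjective b
    refine ⟨Algebra.TensorProduct.lmul' R b, (Ideal.Quotient.eq).2 ?_⟩
    simp [I, KaehlerDifferential.ideal, RingHom.mem_ker]
  exact _root_.finite_projective_quotient_pow I
    (fun m => ⟨GradedPiece.finite_of_surjective I hAI m, GradedPiece.projective I m A⟩) n

end DifferentiallySmooth

/-! ### Bases of sections -/

section Sections

variable {X Y : Scheme.{u}}

theorem presheaf_map_map_apply (M : X.Modules) {U V W : X.Opens} (h : V ≤ U) (h' : W ≤ V)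
    (s : Γ(M, U)) :
    M.presheaf.map (homOfLE h').op (M.presheaf.map (homOfLE h).op s) =
      M.presheaf.map (homOfLE (h'.trans h)).op s := by
  rw [← ConcreteCategory.comp_apply, ← Functor.map_comp]
  rfl

theorem app_presheaf_map {M N : X.Modules} (φ : M ⟶ N) {U V : X.Opens} (h : V ≤ U) (s : Γ(M, U)) :
    φ.app V (M.presheaf.map (homOfLE h).op s) = N.presheaf.map (homOfLE h).op (φ.app U s) :=
  ConcreteCategory.congr_hom (φ.mapPresheaf.naturality (homOfLE h).op) s

theorem sum_app_apply {M N : X.Modules} {κ : Type*} (t : Finset κ) (φ : κ → (M ⟶ N))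
    (U : X.Opens) (m : Γ(M, U)) : (∑ k ∈ t, φ k).app U m = ∑ k ∈ t, (φ k).app U m :=
  map_sum (AddMonoidHom.mk' (fun ψ : M ⟶ N => ψ.app U m) fun _ _ => rfl) φ t

theorem isIso_of_bijective_app {M N : X.Modules} (φ : M ⟶ N)
    (h : ∀ W, Function.Bijective (φ.app W)) : IsIso φ :=
  Modules.Hom.isIso_iff_isIso_app.2 fun W => (ConcreteCategory.isIso_iff_bijective _).2 (h W)

theorem bijective_app_of_isIso {M N : X.Modules} (φ : M ⟶ N) [IsIso φ] (W : X.Opens) :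
    Function.Bijective (φ.app W) :=
  (ConcreteCategory.isIso_iff_bijective _).1 inferInstance

variable {ι : Type*} [Fintype ι]

theorem app_sum_smul {M N : X.Modules} (φ : M ⟶ N) {U V : X.Opens} (h : V ≤ U)
    (s : ι → Γ(M, U)) (c : ι → Γ(X, V)) :
    φ.app V (∑ i, c i • M.presheaf.map (homOfLE h).op (s i)) =
      ∑ i, c i • N.presheaf.map (homOfLE h).op (φ.app U (s i)) := by
  simp_rw [map_sum, Modules.Hom.app_smul, app_presheaf_map]

/-- The sections `s i` of `M` over `U` form a basis of `M|_U`: for every `W ≤ U`, every section of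
`M` over `W` is a unique linear combination of the `s i|_W`. -/
def IsBasisOn (M : X.Modules) (U : X.Opens) (s : ι → Γ(M, U)) : Prop :=
  ∀ (W : X.Opens) (h : W ≤ U), Function.Bijective
    fun c : ι → Γ(X, W) => ∑ i, c i • M.presheaf.map (homOfLE h).op (s i)

namespace IsBasisOn

theorem restrict {M : X.Modules} {U : X.Opens} {s : ι → Γ(M, U)} (hs : IsBasisOn M U s)
    {V : X.Opens} (h : V ≤ U) : IsBasisOn M V fun i => M.presheaf.map (homOfLE h).op (s i) := by
  intro W hW
  simp_rw [presheaf_map_map_apply]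
  exact hs W (hW.trans h)

theorem map_iff {M N : X.Modules} (φ : M ⟶ N) {U : X.Opens}
    (hφ : ∀ W ≤ U, Function.Bijective (φ.app W)) (s : ι → Γ(M, U)) :
    IsBasisOn N U (fun i => φ.app U (s i)) ↔ IsBasisOn M U s := by
  refine forall₂_congr fun W hW => ?_
  simp_rw [← app_sum_smul φ]
  exact (hφ W hW).of_comp_iff' _

theorem reindex {M : X.Modules} {U : X.Opens} {s : ι → Γ(M, U)} (hs : IsBasisOn M U s)
    {κ : Type*} [Fintype κ] (e : κ ≃ ι) : IsBasisOn M U (s ∘ e) := by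
  intro W hW
  convert (hs W hW).comp (e.arrowCongr (Equiv.refl _)).bijective using 1
  funext c
  rw [Function.comp_apply, ← e.sum_comp]
  simp

theorem bijective_app {M N : X.Modules} (φ : M ⟶ N) {U : X.Opens} {s : ι → Γ(M, U)}
    (hs : IsBasisOn M U s) (hφs : IsBasisOn N U (fun i => φ.app U (s i)))
    {W : X.Opens} (hW : W ≤ U) : Function.Bijective (φ.app W) := by
  have h := hφs W hW
  simp_rw [← app_sum_smul φ] at h
  exact (Function.Bijective.of_comp_iff _ (hs W hW)).1 h

end IsBasisOn

/-! ### Free modules -/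

/-- The structure sheaf as a module over itself. -/
abbrev unitModule (X : Scheme.{u}) : X.Modules := SheafOfModules.unit X.ringCatSheaf

/-- The free module on a type. -/
abbrev freeModule (X : Scheme.{u}) (I : Type u) : X.Modules :=
  (SheafOfModules.free I : SheafOfModules X.ringCatSheaf)

section FreeModule

variable {I : Type u}

/-- Families of global sections, which in Mathlib are compatible families over all opens, are
determined by their value on `⊤`. -/
def globalSectionsEquiv (M : X.Modules) : SheafOfModules.sections M ≃ Γ(M, (⊤ : X.Opens)) where
  toFun s := s.val (.op ⊤)
  invFun s := ⟨fun U => M.presheaf.map (homOfLE (le_top : U.unop ≤ ⊤)).op s,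
    fun f => presheaf_map_map_apply M le_top f.unop.le s⟩
  left_inv s := by
    ext U
    exact s.property (homOfLE (le_top : U.unop ≤ ⊤)).op
  right_inv s := by
    change M.presheaf.map (𝟙 _) s = s
    simp

/-- Morphisms from a free module are families of global sections. -/
def freeModuleHomEquiv (M : X.Modules) (I : Type u) :
    (freeModule X I ⟶ M) ≃ (I → Γ(M, (⊤ : X.Opens))) :=
  (SheafOfModules.freeHomEquiv M).trans (Equiv.piCongrRight fun _ => globalSectionsEquiv M)

/-- The standard global sections of a free module. -/
def freeModuleBasis (X : Scheme.{u}) (I : Type u) : I → Γ(freeModule X I, (⊤ : X.Opens)) :=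
  freeModuleHomEquiv _ I (𝟙 _)

theorem freeModuleHomEquiv_apply {M : X.Modules} (φ : freeModule X I ⟶ M) (i : I) :
    freeModuleHomEquiv M I φ i = φ.app ⊤ (freeModuleBasis X I i) := rfl

theorem freeModuleHomEquiv_comp {M N : X.Modules} (φ : freeModule X I ⟶ M) (ψ : M ⟶ N) (i : I) :
    freeModuleHomEquiv N I (φ ≫ ψ) i = ψ.app ⊤ (freeModuleHomEquiv M I φ i) := rfl

/-- The coordinate inclusions of a free module. -/
def freeModuleIncl (X : Scheme.{u}) (i : I) : unitModule X ⟶ freeModule X I :=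
  SheafOfModules.ιFree i

theorem smul_freeModuleBasis {W : X.Opens} (i : I) (c : Γ(X, W)) :
    c • (freeModule X I).presheaf.map (homOfLE le_top).op (freeModuleBasis X I i) =
      (freeModuleIncl X i).app W (show Γ(unitModule X, W) from c) := by
  have hi : freeModuleBasis X I i =
      (freeModuleIncl X i).app ⊤ (show Γ(unitModule X, ⊤) from (1 : Γ(X, ⊤))) := rfl
  rw [hi, ← app_presheaf_map, ← Modules.Hom.app_smul]
  congr 1
  change c * X.presheaf.map (homOfLE le_top).op 1 = c
  rw [map_one]
  exact mul_one c

open Classical in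
/-- The coordinate projections of a free module. -/
def freeModuleProj (X : Scheme.{u}) (j : I) : freeModule X I ⟶ unitModule X :=
  Limits.Cofan.IsColimit.desc (SheafOfModules.isColimitFreeCofan I)
    fun i => if i = j then 𝟙 (SheafOfModules.unit X.ringCatSheaf) else 0

open Classical in
theorem freeModuleIncl_comp_proj (i j : I) :
    freeModuleIncl X i ≫ freeModuleProj X j = if i = j then 𝟙 (unitModule X) else 0 :=
  Limits.Cofan.IsColimit.fac (SheafOfModules.isColimitFreeCofan I) _ i

variable [Fintype I]

theorem sum_freeModuleProj_comp_incl :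
    ∑ i : I, freeModuleProj X i ≫ freeModuleIncl X i = 𝟙 (freeModule X I) := by
  refine Limits.Cofan.IsColimit.hom_ext (SheafOfModules.isColimitFreeCofan I) _ _ fun j => ?_
  change freeModuleIncl X j ≫ _ = freeModuleIncl X j ≫ 𝟙 _
  rw [Preadditive.comp_sum, Finset.sum_eq_single j]
  · rw [← Category.assoc, freeModuleIncl_comp_proj, if_pos rfl, Category.id_comp,
      Category.comp_id]
  · intro i _ hi
    rw [← Category.assoc, freeModuleIncl_comp_proj, if_neg hi.symm, Limits.zero_comp]
  · exact fun hj => absurd (Finset.mem_univ j) hj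

theorem freeModuleProj_app_sum {W : X.Opens} (c : I → Γ(X, W)) (j : I) :
    (freeModuleProj X j).app W
      (∑ i, (freeModuleIncl X i).app W (show Γ(unitModule X, W) from c i)) = c j := by
  rw [map_sum, Finset.sum_eq_single j]
  · rw [← ConcreteCategory.comp_apply, ← Modules.Hom.comp_app, freeModuleIncl_comp_proj,
      if_pos rfl]
    rfl
  · intro i _ hi
    rw [← ConcreteCategory.comp_apply, ← Modules.Hom.comp_app, freeModuleIncl_comp_proj,
      if_neg hi]
    rfl
  · exact fun hj => absurd (Finset.mem_univ j) hj

theorem isBasisOn_freeModuleBasis (X : Scheme.{u}) (I : Type u) [Fintype I] :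
    IsBasisOn (freeModule X I) ⊤ (freeModuleBasis X I) := by
  intro W hW
  simp_rw [smul_freeModuleBasis]
  constructor
  · intro c d hcd
    funext j
    rw [← freeModuleProj_app_sum c j, ← freeModuleProj_app_sum d j]
    exact congrArg _ hcd
  · intro m
    refine ⟨fun i => (freeModuleProj X i).app W m, ?_⟩
    have hm := congrArg (fun φ : freeModule X I ⟶ freeModule X I => φ.app W m)
      sum_freeModuleProj_comp_incl
    rw [sum_app_apply] at hm
    exact hm

theorem IsBasisOn.isIso_freeModuleHomEquiv_symm {M : X.Modules} {s : I → Γ(M, (⊤ : X.Opens))}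
    (hs : IsBasisOn M ⊤ s) : IsIso ((freeModuleHomEquiv M I).symm s) := by
  refine isIso_of_bijective_app _ fun W =>
    (isBasisOn_freeModuleBasis X I).bijective_app _ ?_ le_top
  convert hs using 2 with i
  rw [← freeModuleHomEquiv_apply, Equiv.apply_symm_apply]

theorem isBasisOn_freeModuleHomEquiv {M : X.Modules} (φ : freeModule X I ⟶ M) [IsIso φ] :
    IsBasisOn M ⊤ (freeModuleHomEquiv M I φ) :=
  (IsBasisOn.map_iff φ (fun W _ => bijective_app_of_isIso φ W) _).2
    (isBasisOn_freeModuleBasis X I)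

end FreeModule

theorem IsBasisOn.map_iff_of_le {M : X.Modules} {U V : X.Opens} (s : ι → Γ(M, U)) (h : V ≤ U)
    (h' : U ≤ V) :
    IsBasisOn M V (fun i => M.presheaf.map (homOfLE h).op (s i)) ↔ IsBasisOn M U s := by
  refine ⟨fun hs => ?_, fun hs => hs.restrict h⟩
  obtain rfl := le_antisymm h h'
  convert hs using 2 with i
  exact (ConcreteCategory.congr_hom (M.presheaf.map_id _) (s i)).symm

theorem isBasisOn_restrict_iff {M : Y.Modules} (j : X ⟶ Y) [IsOpenImmersion j] {U : X.Opens}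
    {s : ι → Γ(M.restrict j, U)} :
    IsBasisOn (M.restrict j) U s ↔ IsBasisOn M (j ''ᵁ U) (fun i => (s i : Γ(M, j ''ᵁ U))) := by
  have hcomp (W : X.Opens) (h : W ≤ U) : (fun c : ι → Γ(X, W) =>
      ∑ i, c i • (M.restrict j).presheaf.map (homOfLE h).op (s i)) =
      (fun c : ι → Γ(Y, j ''ᵁ W) => (show Γ(M, j ''ᵁ W) from
        ∑ i, c i • M.presheaf.map (homOfLE (j.image_mono h)).op (s i : Γ(M, j ''ᵁ U)))) ∘
      (fun c i => (j.appIso W).inv (c i)) := rfl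
  have hbij (W : X.Opens) :
      Function.Bijective (fun (c : ι → Γ(X, W)) i => (j.appIso W).inv (c i)) :=
    Function.Bijective.piMap fun _ =>
      (ConcreteCategory.isIso_iff_bijective (j.appIso W).inv).1 inferInstance
  constructor
  · intro h W' hW'
    obtain ⟨W, rfl⟩ : ∃ W, W' = j ''ᵁ W := ⟨j ⁻¹ᵁ W', by
      rw [Scheme.Hom.image_preimage_eq_opensRange_inf, inf_eq_right.2]
      exact hW'.trans (Scheme.Hom.image_le_opensRange _ _)⟩
    have hW : W ≤ U := (Scheme.Hom.image_le_image_iff j W U).1 hW'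
    have hbijW := h W hW
    rw [hcomp W hW] at hbijW
    exact (Function.Bijective.of_comp_iff _ (hbij W)).1 hbijW
  · intro h W hW
    rw [hcomp W hW]
    exact (Function.Bijective.of_comp_iff _ (hbij W)).2 (h _ (j.image_mono hW))

theorem IsLocallyFreeOfFiniteRank.exists_isBasisOn {M : X.Modules}
    (hM : IsLocallyFreeOfFiniteRank M) (x : X) :
    ∃ (U : X.Opens) (n : ℕ) (s : Fin n → Γ(M, U)), x ∈ U ∧ IsBasisOn M U s := by
  obtain ⟨U, n, hx, ⟨e⟩⟩ := hM x
  let φ : freeModule U.toScheme (ULift.{u} (Fin n)) ⟶ M.restrict U.ι := e.inv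
  have hφ := (isBasisOn_restrict_iff U.ι).1 (isBasisOn_freeModuleHomEquiv φ)
  have hU : U ≤ U.ι ''ᵁ ⊤ := U.ι_image_top.ge
  exact ⟨U, n, _, hx, (hφ.restrict hU).reindex Equiv.ulift.symm⟩

theorem isLocallyFreeOfFiniteRank_of_isBasisOn {M : X.Modules}
    (h : ∀ x : X, ∃ (U : X.Opens) (κ : Type) (_ : Fintype κ) (s : κ → Γ(M, U)),
      x ∈ U ∧ IsBasisOn M U s) : IsLocallyFreeOfFiniteRank M := by
  intro x
  obtain ⟨U, κ, _, s, hx, hs⟩ := h x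
  refine ⟨U, Fintype.card κ, hx, ?_⟩
  have hU : U.ι ''ᵁ ⊤ ≤ U := U.ι_image_top.le
  have hs' := (isBasisOn_restrict_iff U.ι).2
    ((hs.restrict hU).reindex (Equiv.ulift.{u}.trans (Fintype.equivFin κ).symm))
  have := hs'.isIso_freeModuleHomEquiv_symm
  exact ⟨(@asIso _ _ _ _ _ this).symm⟩

end Sections

/-! ### Pullbacks of sections -/

section Pullback

variable {X Y Z : Scheme.{u}} {ι : Type*} [Fintype ι]

/-- The pullback of a section along a morphism of schemes. -/
def pullbackSection (q : Y ⟶ X) {M : X.Modules} {U : X.Opens} (s : Γ(M, U)) :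
    Γ((Modules.pullback q).obj M, q ⁻¹ᵁ U) :=
  ((Modules.pullbackPushforwardAdjunction q).unit.app M).app U s

theorem pullbackSection_map (q : Y ⟶ X) {M : X.Modules} {U V : X.Opens} (h : V ≤ U)
    (s : Γ(M, U)) : pullbackSection q (M.presheaf.map (homOfLE h).op s) =
      ((Modules.pullback q).obj M).presheaf.map (homOfLE (q.preimage_mono h)).op
        (pullbackSection q s) :=
  app_presheaf_map _ h s

theorem pullbackSection_comp (q : Y ⟶ X) (r : Z ⟶ Y) {M : X.Modules} {U : X.Opens}
    (s : Γ(M, U)) :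
    ((Modules.pullbackComp r q).inv.app M).app (r ⁻¹ᵁ q ⁻¹ᵁ U) (pullbackSection (r ≫ q) s) =
      pullbackSection r (pullbackSection q s) := by
  have hunit := unit_conjugateEquiv
    ((Modules.pullbackPushforwardAdjunction q).comp (Modules.pullbackPushforwardAdjunction r))
    (Modules.pullbackPushforwardAdjunction (r ≫ q)) (Modules.pullbackComp r q).inv M
  rw [Modules.conjugateEquiv_pullbackComp_inv] at hunit
  exact (congrArg (fun φ => φ.app U s) hunit).symm

theorem restrictFunctorIsoPullback_hom_app_map (j : X ⟶ Y) [IsOpenImmersion j] {M : Y.Modules}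
    {U : Y.Opens} (s : Γ(M, U)) :
    ((Modules.restrictFunctorIsoPullback j).hom.app M).app (j ⁻¹ᵁ U)
      (show Γ(M.restrict j, j ⁻¹ᵁ U) from M.presheaf.map (homOfLE (j.image_preimage_le U)).op s) =
      pullbackSection j s :=
  congrArg (fun φ => φ.app U s) (Adjunction.unit_leftAdjointUniq_hom_app
    (Modules.restrictAdjunction j) (Modules.pullbackPushforwardAdjunction j) M)

namespace IsBasisOn

theorem pullbackSection_iff_of_isOpenImmersion (j : X ⟶ Y) [IsOpenImmersion j] {M : Y.Modules}
    {U : Y.Opens} (hU : U ≤ j.opensRange) (s : ι → Γ(M, U)) :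
    IsBasisOn ((Modules.pullback j).obj M) (j ⁻¹ᵁ U) (fun i => pullbackSection j (s i)) ↔
      IsBasisOn M U s := by
  have hmap := IsBasisOn.map_iff ((Modules.restrictFunctorIsoPullback j).hom.app M)
    (fun W (_ : W ≤ j ⁻¹ᵁ U) => bijective_app_of_isIso _ W)
    (fun i => (show Γ(M.restrict j, j ⁻¹ᵁ U) from
      M.presheaf.map (homOfLE (j.image_preimage_le U)).op (s i)))
  rw [funext fun i => restrictFunctorIsoPullback_hom_app_map j (s i)] at hmap
  refine hmap.trans ((isBasisOn_restrict_iff j).trans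
    (IsBasisOn.map_iff_of_le s (j.image_preimage_le U) ?_))
  rw [Scheme.Hom.image_preimage_eq_opensRange_inf]
  exact le_inf hU le_rfl

theorem pullbackSection_comp_iff (q : Y ⟶ X) (r : Z ⟶ Y) {M : X.Modules} {U : X.Opens}
    (s : ι → Γ(M, U)) :
    IsBasisOn ((Modules.pullback r).obj ((Modules.pullback q).obj M)) (r ⁻¹ᵁ q ⁻¹ᵁ U)
      (fun i => pullbackSection r (pullbackSection q (s i))) ↔
    IsBasisOn ((Modules.pullback (r ≫ q)).obj M) ((r ≫ q) ⁻¹ᵁ U)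
      (fun i => pullbackSection (r ≫ q) (s i)) := by
  have hmap := IsBasisOn.map_iff ((Modules.pullbackComp r q).inv.app M)
    (fun W (_ : W ≤ r ⁻¹ᵁ q ⁻¹ᵁ U) => bijective_app_of_isIso _ W)
    (fun i => (pullbackSection (r ≫ q) (s i)))
  rwa [funext fun i => pullbackSection_comp q r (s i)] at hmap

theorem pullbackSection_top (q : Y ⟶ X) {M : X.Modules} {I : Type u} [Fintype I]
    {s : I → Γ(M, (⊤ : X.Opens))} (hs : IsBasisOn M ⊤ s) :
    IsBasisOn ((Modules.pullback q).obj M) (q ⁻¹ᵁ ⊤) (fun i => pullbackSection q (s i)) := by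
  let σ := (freeModuleHomEquiv M I).symm s
  have hσ : IsIso σ := hs.isIso_freeModuleHomEquiv_symm
  let g : freeModule Y I ⟶ (Modules.pullback q).obj M :=
    (freeModuleHomEquiv _ I).symm (fun i => pullbackSection q (s i))
  have hgs : freeModuleHomEquiv _ I g = fun i => pullbackSection q (s i) :=
    (freeModuleHomEquiv _ I).apply_symm_apply _
  -- `g` is an isomorphism by the Yoneda lemma: morphisms out of both sides are families of
  -- global sections of the target.
  have hg : IsIso g := by
    rw [isIso_iff_coyoneda_map_bijective]
    intro N
    have hfactor : freeModuleHomEquiv N I ∘ (g ≫ ·) =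
        freeModuleHomEquiv ((Modules.pushforward q).obj N) I ∘ (σ ≫ ·) ∘
          (Modules.pullbackPushforwardAdjunction q).homEquiv M N := by
      funext φ i
      simp only [Function.comp_apply, freeModuleHomEquiv_comp]
      rw [hgs, Equiv.apply_symm_apply, Adjunction.homEquiv_unit]
      rfl
    rw [← (freeModuleHomEquiv N I).bijective.of_comp_iff', hfactor]
    exact (Equiv.bijective _).comp (((isIso_iff_coyoneda_map_bijective σ).1 hσ _).comp
      (Equiv.bijective _))
  exact hgs ▸ isBasisOn_freeModuleHomEquiv g

theorem pullback (q : Y ⟶ X) {M : X.Modules} {U : X.Opens} {s : ι → Γ(M, U)}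
    (hs : IsBasisOn M U s) :
    IsBasisOn ((Modules.pullback q).obj M) (q ⁻¹ᵁ U) (fun i => pullbackSection q (s i)) := by
  let e : ULift.{u} (Fin (Fintype.card ι)) ≃ ι := Equiv.ulift.trans (Fintype.equivFin ι).symm
  have hsU := (pullbackSection_iff_of_isOpenImmersion U.ι U.opensRange_ι.ge _).2 (hs.reindex e)
  have hqU := (hsU.restrict U.ι_preimage_self.ge).pullbackSection_top (q ∣_ U)
  simp_rw [pullbackSection_map] at hqU
  rw [map_iff_of_le _ _ (Scheme.Hom.preimage_mono _ le_top), pullbackSection_comp_iff,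
    morphismRestrict_ι, ← pullbackSection_comp_iff,
    pullbackSection_iff_of_isOpenImmersion _ (q ⁻¹ᵁ U).opensRange_ι.ge] at hqU
  simpa only [Function.comp_def, Equiv.apply_symm_apply] using hqU.reindex e.symm

end IsBasisOn

end Pullback

/-! ### Local bases from finite projective modules of sections -/

section InvertingAnElement

variable {A N : Type*} [CommRing A] [AddCommGroup N] [Module A N] {ι : Type*}

theorem exists_pow_smul_eq_zero_forall [Finite ι] {r : A} {x : ι → N}
    (h : ∀ i, ∃ k : ℕ, r ^ k • x i = 0) : ∃ k : ℕ, ∀ i, r ^ k • x i = 0 := by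
  choose k hk using h
  obtain ⟨K, hK⟩ := Finite.exists_le k
  exact ⟨K, fun i => by rw [← Nat.sub_add_cancel (hK i), pow_add, mul_smul, hk, smul_zero]⟩

variable [Fintype ι]

/-- The family `v` becomes a basis of the localization of `N` away from `r`. -/
structure IsBasisAfterInverting (r : A) (v : ι → N) : Prop where
  exists_pow_smul_eq_zero : ∀ c : ι → A, ∑ i, c i • v i = 0 → ∃ k : ℕ, ∀ i, r ^ k • c i = 0
  exists_pow_smul_eq_sum : ∀ m : N, ∃ (k : ℕ) (c : ι → A), r ^ k • m = ∑ i, c i • v i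

theorem exists_isBasisAfterInverting_of_basis {r : A}
    (b : Module.Basis ι (Localization (Submonoid.powers r))
      (LocalizedModule (Submonoid.powers r) N)) :
    ∃ v : ι → N, IsBasisAfterInverting r v := by
  let P := Submonoid.powers r
  let f := LocalizedModule.mkLinearMap P N
  obtain ⟨⟨_, k, rfl⟩, hk⟩ := IsLocalizedModule.exist_integer_multiples_of_finite P f b
  choose v hv using hk
  have hunit : IsUnit (algebraMap A (Localization P) (r ^ k)) :=
    IsLocalization.map_units (Localization P) (⟨r ^ k, k, rfl⟩ : P)
  let w := b.isUnitSMul (fun _ => hunit)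
  have hw (i : ι) : w i = f (v i) := by
    rw [hv, Module.Basis.isUnitSMul_apply, algebraMap_smul]
  refine ⟨v, fun c hc => exists_pow_smul_eq_zero_forall fun i => ?_, fun m => ?_⟩
  · have hsum : ∑ i, algebraMap A (Localization P) (c i) • w i = 0 := by
      simp_rw [hw, algebraMap_smul, ← map_smul, ← map_sum, hc, map_zero]
    have hci := Fintype.linearIndependent_iff.1 w.linearIndependent _ hsum i
    obtain ⟨⟨_, l, rfl⟩, hl⟩ := (IsLocalization.map_eq_zero_iff P _ _).1 hci
    exact ⟨l, hl⟩
  · obtain ⟨⟨_, l, rfl⟩, hl⟩ :=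
      IsLocalization.exist_integer_multiples_of_finite P (w.repr (f m))
    choose c hc using hl
    have hfm : f (r ^ l • m) = f (∑ i, c i • v i) := by
      rw [map_smul, map_sum, ← w.sum_repr (f m), Finset.smul_sum]
      refine Finset.sum_congr rfl fun i _ => ?_
      rw [map_smul, ← hw, ← smul_assoc, ← hc i, algebraMap_smul]
    obtain ⟨⟨_, j, rfl⟩, hj⟩ := (IsLocalizedModule.eq_iff_exists P f).1 hfm
    have hj' : r ^ j • r ^ l • m = r ^ j • ∑ i, c i • v i := hj
    refine ⟨j + l, fun i => r ^ j * c i, ?_⟩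
    simp_rw [pow_add, mul_smul, hj', Finset.smul_sum]

theorem exists_isBasisAfterInverting (A N : Type*) [CommRing A] [AddCommGroup N] [Module A N]
    [Module.Finite A N] [Module.Projective A N] (p : PrimeSpectrum A) :
    ∃ r ∉ p.asIdeal, ∃ (n : ℕ) (v : Fin n → N), IsBasisAfterInverting r v := by
  have : Module.FinitePresentation A N := Module.finitePresentation_of_projective A N
  let S := p.asIdeal.primeCompl
  have : Module.Free (Localization S) (LocalizedModule S N) :=
    Module.free_of_flat_of_isLocalRing
  obtain ⟨r, hr, b, -⟩ := Module.FinitePresentation.exists_basis_localizedModule_powers S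
    (LocalizedModule.mkLinearMap S N) (Localization S)
    (Module.finBasis (Localization S) (LocalizedModule S N))
  exact ⟨r, hr, _, exists_isBasisAfterInverting_of_basis b⟩

theorem IsBasisAfterInverting.mul_left {r : A} {v : ι → N} (hv : IsBasisAfterInverting r v)
    (g : A) : IsBasisAfterInverting (g * r) v where
  exists_pow_smul_eq_zero c hc := by
    obtain ⟨k, hk⟩ := hv.exists_pow_smul_eq_zero c hc
    exact ⟨k, fun i => by rw [mul_pow, mul_smul, hk, smul_zero]⟩
  exists_pow_smul_eq_sum m := by
    obtain ⟨k, c, hc⟩ := hv.exists_pow_smul_eq_sum m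
    refine ⟨k, fun i => g ^ k * c i, ?_⟩
    simp_rw [mul_pow, mul_smul, hc, Finset.smul_sum]

end InvertingAnElement

section LocalBases

variable {X : Scheme.{u}} {ι : Type*} [Fintype ι]

theorem section_ext (M : X.Modules) {U : X.Opens} {s t : Γ(M, U)}
    (h : ∀ x ∈ U, ∃ (V : X.Opens) (hV : V ≤ U), x ∈ V ∧
      M.presheaf.map (homOfLE hV).op s = M.presheaf.map (homOfLE hV).op t) : s = t :=
  TopCat.Presheaf.IsSheaf.section_ext M.isSheaf h

theorem presheaf_map_sum_smul (M : X.Modules) {U V W : X.Opens} (s : ι → Γ(M, U))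
    (hV : V ≤ U) (hW : W ≤ V) (c : ι → Γ(X, V)) :
    M.presheaf.map (homOfLE hW).op (∑ i, c i • M.presheaf.map (homOfLE hV).op (s i)) =
      ∑ i, X.presheaf.map (homOfLE hW).op (c i) •
        M.presheaf.map (homOfLE (hW.trans hV)).op (s i) := by
  simp_rw [map_sum, Modules.map_smul, presheaf_map_map_apply]

/-- The sections `s i` of `M` over `U` form a basis of `M|_V` for arbitrarily small neighbourhoods
`V` of every point of `U`, in the weak sense that only sections over `V` itself are tested. -/
def IsBasisLocallyOn (M : X.Modules) (U : X.Opens) (s : ι → Γ(M, U)) : Prop :=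
  ∀ W ≤ U, ∀ x ∈ W, ∃ V, ∃ hV : V ≤ U, V ≤ W ∧ x ∈ V ∧ Function.Bijective
    fun c : ι → Γ(X, V) => ∑ i, c i • M.presheaf.map (homOfLE hV).op (s i)

namespace IsBasisLocallyOn

variable {M : X.Modules} {U : X.Opens} {s : ι → Γ(M, U)}

theorem injective (h : IsBasisLocallyOn M U s) {W : X.Opens} (hW : W ≤ U) : Function.Injective
    fun c : ι → Γ(X, W) => ∑ i, c i • M.presheaf.map (homOfLE hW).op (s i) := by
  intro c d hcd
  funext i
  refine TopCat.Presheaf.IsSheaf.section_ext X.sheaf.property fun x hx => ?_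
  obtain ⟨V, hVU, hV, hxV, hbij⟩ := h W hW x hx
  have hcdV := congrArg (M.presheaf.map (homOfLE hV).op) hcd
  simp only [presheaf_map_sum_smul] at hcdV
  exact ⟨V, hV, hxV, congrFun (hbij.1 hcdV) i⟩

theorem isBasisOn (h : IsBasisLocallyOn M U s) : IsBasisOn M U s := by
  intro W hW
  refine ⟨h.injective hW, fun m => ?_⟩
  choose V hVU hVW hxV hbij using fun x : W => h W hW x.1 x.2
  choose c hc using fun x : W => (hbij x).2 (M.presheaf.map (homOfLE (hVW x)).op m)
  have hcompat (i : ι) (x y : W) :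
      X.presheaf.map (homOfLE (inf_le_left : V x ⊓ V y ≤ V x)).op (c x i) =
      X.presheaf.map (homOfLE (inf_le_right : V x ⊓ V y ≤ V y)).op (c y i) := by
    have hx := congrArg (M.presheaf.map (homOfLE (inf_le_left : V x ⊓ V y ≤ V x)).op) (hc x)
    have hy := congrArg (M.presheaf.map (homOfLE (inf_le_right : V x ⊓ V y ≤ V y)).op) (hc y)
    rw [presheaf_map_sum_smul, presheaf_map_map_apply] at hx hy
    exact congrFun (h.injective (inf_le_left.trans (hVU x)) (hx.trans hy.symm)) i
  have hglue (i : ι) : ∃ d : Γ(X, W), ∀ x, X.presheaf.map (homOfLE (hVW x)).op d = c x i :=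
    (TopCat.Sheaf.existsUnique_gluing' X.sheaf V W (fun x => homOfLE (hVW x))
      (fun x hx => TopologicalSpace.Opens.mem_iSup.2 ⟨⟨x, hx⟩, hxV _⟩)
      (fun x => c x i) (hcompat i)).exists
  choose d hd using hglue
  refine ⟨d, section_ext M fun x hx => ⟨V ⟨x, hx⟩, hVW _, hxV _, ?_⟩⟩
  rw [← hc ⟨x, hx⟩]
  dsimp only
  rw [presheaf_map_sum_smul]
  simp_rw [hd]

end IsBasisLocallyOn

/-- The sections of `M` over the basic opens of `U` are localizations of the sections over `U`. -/
structure LocalizesOn (M : X.Modules) (U : X.Opens) : Prop where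
  exists_pow_smul_eq_zero : ∀ (f : Γ(X, U)) (m : Γ(M, U)),
    M.presheaf.map (homOfLE (X.basicOpen_le f)).op m = 0 → ∃ n : ℕ, f ^ n • m = 0
  exists_map_eq : ∀ (f : Γ(X, U)) (m : Γ(M, X.basicOpen f)), ∃ (n : ℕ) (m' : Γ(M, U)),
    M.presheaf.map (homOfLE (X.basicOpen_le f)).op m' =
      X.presheaf.map (homOfLE (X.basicOpen_le f)).op f ^ n • m

theorem localizesOn_unitModule {U : X.Opens} (hU : IsAffineOpen U) :
    LocalizesOn (unitModule X) U where
  exists_pow_smul_eq_zero f m h :=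
    exists_pow_mul_eq_zero_of_res_basicOpen_eq_zero_of_isCompact X hU.isCompact m f h
  exists_map_eq f m := exists_eq_pow_mul_of_isAffineOpen X U hU f m

theorem exists_common_denominator {κ : Type*} [Finite κ] {U : X.Opens} (hU : IsAffineOpen U)
    (f : Γ(X, U)) (c : κ → Γ(X, X.basicOpen f)) :
    ∃ (n : ℕ) (d : κ → Γ(X, U)), ∀ i, X.presheaf.map (homOfLE (X.basicOpen_le f)).op (d i) =
      X.presheaf.map (homOfLE (X.basicOpen_le f)).op f ^ n * c i := by
  choose n d hd using fun i => exists_eq_pow_mul_of_isAffineOpen X U hU f (c i)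
  obtain ⟨K, hK⟩ := Finite.exists_le n
  refine ⟨K, fun i => f ^ (K - n i) * d i, fun i => ?_⟩
  rw [map_mul, map_pow]
  refine (congrArg _ (hd i)).trans ?_
  rw [← mul_assoc]
  exact congrArg (· * c i) (pow_sub_mul_pow _ (hK i))

theorem IsBasisOn.localizesOn {M : X.Modules} {U : X.Opens} {s : ι → Γ(M, U)}
    (hs : IsBasisOn M U s) (hU : IsAffineOpen U) : LocalizesOn M U where
  exists_pow_smul_eq_zero f m h := by
    obtain ⟨c, rfl⟩ := (hs U le_rfl).2 m
    simp only [presheaf_map_sum_smul] at h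
    have hc := (hs _ (X.basicOpen_le f)).1 (a₂ := 0) (h.trans (by simp))
    obtain ⟨K, hK⟩ : ∃ K : ℕ, ∀ i, f ^ K • c i = 0 := exists_pow_smul_eq_zero_forall fun i =>
      (localizesOn_unitModule hU).exists_pow_smul_eq_zero f (c i) (congrFun hc i)
    refine ⟨K, ?_⟩
    simp_rw [Finset.smul_sum, ← smul_assoc, hK, zero_smul, Finset.sum_const_zero]
  exists_map_eq f m := by
    obtain ⟨c, rfl⟩ := (hs _ (X.basicOpen_le f)).2 m
    obtain ⟨n, d, hd⟩ := exists_common_denominator hU f c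
    refine ⟨n, ∑ i, d i • M.presheaf.map (homOfLE le_rfl).op (s i), ?_⟩
    simp only [presheaf_map_sum_smul, Finset.smul_sum, hd, mul_smul]

theorem mem_basicOpen_iff_notMem_primeIdealOf {U : X.Opens} (hU : IsAffineOpen U) (x : U)
    (f : Γ(X, U)) : x.1 ∈ X.basicOpen f ↔ f ∉ (hU.primeIdealOf x).asIdeal := by
  rw [← PrimeSpectrum.mem_basicOpen, ← hU.fromSpec_preimage_basicOpen f]
  change _ ↔ hU.fromSpec (hU.primeIdealOf x) ∈ X.basicOpen f
  rw [hU.fromSpec_primeIdealOf]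

namespace LocalizesOn

variable {M : X.Modules} {U : X.Opens}

theorem bijective_of_isBasisAfterInverting (hM : LocalizesOn M U) (hU : IsAffineOpen U)
    {f : Γ(X, U)} {v : ι → Γ(M, U)} (hv : IsBasisAfterInverting f v) :
    Function.Bijective fun c : ι → Γ(X, X.basicOpen f) =>
      ∑ i, c i • M.presheaf.map (homOfLE (X.basicOpen_le f)).op (v i) := by
  have hf : IsUnit (X.presheaf.map (homOfLE (X.basicOpen_le f)).op f) :=
    RingedSpace.isUnit_res_basicOpen X.toRingedSpace f
  have hmap (c : ι → Γ(X, U)) : M.presheaf.map (homOfLE (X.basicOpen_le f)).op (∑ i, c i • v i) =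
      ∑ i, X.presheaf.map (homOfLE (X.basicOpen_le f)).op (c i) •
        M.presheaf.map (homOfLE (X.basicOpen_le f)).op (v i) := by
    simp_rw [map_sum, Modules.map_smul]
  constructor
  · refine (injective_iff_map_eq_zero (Fintype.linearCombination _
      fun i => M.presheaf.map (homOfLE (X.basicOpen_le f)).op (v i))).2 fun e he => ?_
    obtain ⟨K, d, hd⟩ := exists_common_denominator hU f e
    have hdv : M.presheaf.map (homOfLE (X.basicOpen_le f)).op (∑ i, d i • v i) = 0 := by
      simp_rw [hmap, hd, mul_smul, ← Finset.smul_sum]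
      exact (congrArg _ he).trans (smul_zero _)
    obtain ⟨l, hl⟩ := hM.exists_pow_smul_eq_zero f _ hdv
    simp_rw [Finset.smul_sum, ← smul_assoc] at hl
    obtain ⟨k, hk⟩ := hv.exists_pow_smul_eq_zero _ hl
    funext i
    have hi := congrArg (X.presheaf.map (homOfLE (X.basicOpen_le f)).op) (hk i)
    rwa [smul_eq_mul, smul_eq_mul, map_mul, map_mul, map_pow, map_pow, hd, map_zero,
      (hf.pow k).mul_right_eq_zero, (hf.pow l).mul_right_eq_zero,
      (hf.pow K).mul_right_eq_zero] at hi
  · intro m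
    obtain ⟨k, m', hm'⟩ := hM.exists_map_eq f m
    obtain ⟨l, c, hc⟩ := hv.exists_pow_smul_eq_sum m'
    obtain ⟨a, ha⟩ := hf.pow (l + k)
    refine ⟨fun i => ↑a⁻¹ * X.presheaf.map (homOfLE (X.basicOpen_le f)).op (c i), ?_⟩
    simp_rw [mul_smul, ← Finset.smul_sum, ← hmap, ← hc, Modules.map_smul, hm', map_pow,
      smul_smul, ← pow_add, ← ha, Units.inv_mul, one_smul]

theorem exists_isBasisOn (hM : LocalizesOn M U) (hU : IsAffineOpen U)
    [Module.Finite Γ(X, U) Γ(M, U)] [Module.Projective Γ(X, U) Γ(M, U)] {x : X} (hx : x ∈ U) :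
    ∃ (f : Γ(X, U)) (n : ℕ) (s : Fin n → Γ(M, X.basicOpen f)),
      x ∈ X.basicOpen f ∧ IsBasisOn M (X.basicOpen f) s := by
  obtain ⟨r, hr, n, v, hv⟩ :=
    exists_isBasisAfterInverting Γ(X, U) Γ(M, U) (hU.primeIdealOf ⟨x, hx⟩)
  refine ⟨r, n, fun i => M.presheaf.map (homOfLE (X.basicOpen_le r)).op (v i),
    (mem_basicOpen_iff_notMem_primeIdealOf hU ⟨x, hx⟩ r).2 hr,
    IsBasisLocallyOn.isBasisOn fun W hW y hy => ?_⟩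
  obtain ⟨g, hgW, hyg⟩ := hU.exists_basicOpen_le ⟨y, hy⟩ (X.basicOpen_le r (hW hy))
  have hgr := X.basicOpen_mul g r
  refine ⟨X.basicOpen (g * r), hgr ▸ inf_le_right, (hgr ▸ inf_le_left).trans hgW,
    hgr ▸ ⟨hyg, hW hy⟩, ?_⟩
  simp_rw [presheaf_map_map_apply]
  exact hM.bijective_of_isBasisAfterInverting hU (hv.mul_left g)

end LocalizesOn

end LocalBases

/-! ### Direct images -/

section Pushforward

variable {X Y : Scheme.{u}}

theorem LocalizesOn.pushforward (p : Y ⟶ X) {F : Y.Modules} {U : X.Opens}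
    (hF : LocalizesOn F (p ⁻¹ᵁ U)) : LocalizesOn ((Modules.pushforward p).obj F) U where
  exists_pow_smul_eq_zero f m h := by
    have hzero (V : Y.Opens) (hV : V ≤ p ⁻¹ᵁ U) (hVf : V = Y.basicOpen (p.app U f))
        (h : F.presheaf.map (homOfLE hV).op (show Γ(F, p ⁻¹ᵁ U) from m) = 0) :
        ∃ n : ℕ, p.app U f ^ n • (show Γ(F, p ⁻¹ᵁ U) from m) = 0 := by
      subst hVf
      exact hF.exists_pow_smul_eq_zero _ _ h
    obtain ⟨n, hn⟩ := hzero _ (p.preimage_mono (X.basicOpen_le f)) (preimage_basicOpen p f) h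
    rw [← map_pow] at hn
    exact ⟨n, hn⟩
  exists_map_eq f m := by
    have hlift (V : Y.Opens) (hV : V ≤ p ⁻¹ᵁ U) (hVf : V = Y.basicOpen (p.app U f))
        (m : Γ(F, V)) : ∃ (n : ℕ) (m' : Γ(F, p ⁻¹ᵁ U)), F.presheaf.map (homOfLE hV).op m' =
          Y.presheaf.map (homOfLE hV).op (p.app U f) ^ n • m := by
      subst hVf
      exact hF.exists_map_eq _ _
    have hres : Y.presheaf.map (homOfLE (p.preimage_mono (X.basicOpen_le f))).op (p.app U f) =
        p.app (X.basicOpen f) (X.presheaf.map (homOfLE (X.basicOpen_le f)).op f) :=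
      (ConcreteCategory.congr_hom (p.naturality (homOfLE (X.basicOpen_le f)).op) f).symm
    obtain ⟨n, m', hm'⟩ := hlift _ (p.preimage_mono (X.basicOpen_le f)) (preimage_basicOpen p f) m
    rw [hres, ← map_pow] at hm'
    exact ⟨n, m', hm'⟩

theorem IsBasisOn.pushforward (p : Y ⟶ X) {F : Y.Modules} {U : X.Opens}
    {κ ι : Type*} [Fintype κ] [Fintype ι]
    {b : κ → Γ((Modules.pushforward p).obj (unitModule Y), U)} {t : ι → Γ(F, p ⁻¹ᵁ U)}
    (hb : IsBasisOn ((Modules.pushforward p).obj (unitModule Y)) U b)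
    (ht : IsBasisOn F (p ⁻¹ᵁ U) t) :
    IsBasisOn ((Modules.pushforward p).obj F) U
      fun ji : κ × ι => (show Γ(F, p ⁻¹ᵁ U) from (show Γ(Y, p ⁻¹ᵁ U) from b ji.1) • t ji.2) := by
  intro W hW
  let b' (j : κ) : Γ(Y, p ⁻¹ᵁ W) :=
    Y.presheaf.map (homOfLE (p.preimage_mono hW)).op (show Γ(Y, p ⁻¹ᵁ U) from b j)
  let t' (i : ι) : Γ(F, p ⁻¹ᵁ W) := F.presheaf.map (homOfLE (p.preimage_mono hW)).op (t i)
  have hcoeff : Function.Bijective fun (c : ι → κ → Γ(X, W)) i => ∑ j, p.app W (c i j) * b' j :=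
    Function.Bijective.piMap fun _ => hb W hW
  have hbij := ((ht (p ⁻¹ᵁ W) (p.preimage_mono hW)).comp hcoeff).comp
    ((Equiv.arrowCongr (Equiv.prodComm κ ι) (Equiv.refl Γ(X, W))).trans
      (Equiv.curry ι κ Γ(X, W))).bijective
  have hmap (j : κ) (i : ι) : ((Modules.pushforward p).obj F).presheaf.map (homOfLE hW).op
      (show Γ(F, p ⁻¹ᵁ U) from (show Γ(Y, p ⁻¹ᵁ U) from b j) • t i) =
      (show Γ(F, p ⁻¹ᵁ W) from b' j • t' i) := Modules.map_smul F _ _ _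
  refine (congrArg Function.Bijective (funext fun c => ?_)).mpr hbij
  simp_rw [Fintype.sum_prod_type_right, hmap]
  change ∑ i, ∑ j, p.app W (c (j, i)) • b' j • t' i =
    ∑ i, (∑ j, p.app W (c (j, i)) * b' j) • t' i
  simp_rw [Finset.sum_smul, mul_smul]

end Pushforward

/-! ### Exactness on sections -/

section Exactness

variable {X : Scheme.{u}}

/-- Sections over an open set, as a functor to abelian groups. -/
def sectionsFunctor (U : X.Opens) : X.Modules ⥤ Ab :=
  Modules.toPresheaf X ⋙ (CategoryTheory.evaluation _ _).obj (.op U)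

instance (U : X.Opens) : (sectionsFunctor U).PreservesZeroMorphisms where
  map_zero _ _ := rfl

instance (U : X.Opens) : Limits.PreservesLimitsOfSize.{u, u} (sectionsFunctor U) :=
  have : Limits.PreservesLimitsOfSize.{u, u}
      ((CategoryTheory.evaluation X.Opensᵒᵖ Ab.{u}).obj (.op U)) := ⟨inferInstance⟩
  Limits.comp_preservesLimits _ _

theorem injective_app_of_mono {M N : X.Modules} (φ : M ⟶ N) [Mono φ] (U : X.Opens) :
    Function.Injective (φ.app U) :=
  (AddCommGrpCat.mono_iff_injective ((sectionsFunctor U).map φ)).1 inferInstance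

theorem exact_app_of_exact {T : ShortComplex X.Modules} (hT : T.Exact) [Mono T.f] (U : X.Opens) :
    Function.Exact (T.f.app U) (T.g.app U) := by
  refine fun m => ⟨fun hm => (ShortComplex.ab_exact_iff _).1
    (hT.map_of_mono_of_preservesKernel (sectionsFunctor U) ‹_› inferInstance) m hm, ?_⟩
  rintro ⟨k, rfl⟩
  exact congrArg (fun φ : T.X₁ ⟶ T.X₃ => φ.app U k) T.zero

theorem epi_of_locally_surjective {M N : X.Modules} (φ : M ⟶ N)
    (h : ∀ (U : X.Opens) (n : Γ(N, U)), ∀ x ∈ U, ∃ (V : X.Opens) (hV : V ≤ U) (m : Γ(M, V)),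
      x ∈ V ∧ φ.app V m = N.presheaf.map (homOfLE hV).op n) : Epi φ where
  left_cancellation {P} a b hab := by
    ext U n
    refine section_ext P fun x hx => ?_
    obtain ⟨V, hV, m, hxV, hm⟩ := h U n x hx
    refine ⟨V, hV, hxV, ?_⟩
    rw [← app_presheaf_map, ← app_presheaf_map, ← hm]
    exact congrArg (fun ψ : M ⟶ P => ψ.app V m) hab

theorem LocalizesOn.of_exact {T : ShortComplex X.Modules} (hT : T.Exact) [Mono T.f]
    {U : X.Opens} (h₂ : LocalizesOn T.X₂ U) (h₃ : LocalizesOn T.X₃ U) : LocalizesOn T.X₁ U where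
  exists_pow_smul_eq_zero f m hm := by
    obtain ⟨n, hn⟩ := h₂.exists_pow_smul_eq_zero f (T.f.app U m) (by
      rw [← app_presheaf_map, hm, map_zero])
    exact ⟨n, injective_app_of_mono T.f U (by rw [Modules.Hom.app_smul, hn, map_zero])⟩
  exists_map_eq f m := by
    obtain ⟨n, m', hm'⟩ := h₂.exists_map_eq f (T.f.app _ m)
    obtain ⟨l, hl⟩ := h₃.exists_pow_smul_eq_zero f (T.g.app U m') (by
      rw [← app_presheaf_map, hm', Modules.Hom.app_smul,
        (exact_app_of_exact hT _).apply_apply_eq_zero, smul_zero])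
    obtain ⟨k, hk⟩ := (exact_app_of_exact hT U (f ^ l • m')).1 (by rw [Modules.Hom.app_smul, hl])
    refine ⟨l + n, k, injective_app_of_mono T.f _ ?_⟩
    rw [app_presheaf_map, hk, Modules.map_smul, hm', Modules.Hom.app_smul, map_pow, pow_add,
      mul_smul]

/-- The linear map on sections over `U` given by a morphism of modules. -/
def sectionsLinearMap {M N : X.Modules} (φ : M ⟶ N) (U : X.Opens) :
    Γ(M, U) →ₗ[Γ(X, U)] Γ(N, U) where
  toFun := φ.app U
  map_add' := map_add _
  map_smul' := φ.app_smul

/-- The coordinates of sections with respect to a basis. -/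
def IsBasisOn.basis {M : X.Modules} {U : X.Opens} {ι : Type*} [Fintype ι] {s : ι → Γ(M, U)}
    (hs : IsBasisOn M U s) : Module.Basis ι Γ(X, U) Γ(M, U) :=
  .ofEquivFun (LinearEquiv.ofBijective (Fintype.linearCombination Γ(X, U) s) (by
    convert hs U le_rfl using 1
    funext c
    refine Finset.sum_congr rfl fun i _ => congrArg (c i • ·) ?_
    exact (ConcreteCategory.congr_hom (M.presheaf.map_id _) (s i)).symm)).symm

theorem IsBasisOn.exists_isBasisOn_of_exact {T : ShortComplex X.Modules} (hT : T.Exact) [Mono T.f]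
    {U : X.Opens} (hU : IsAffineOpen U) {ι κ : Type*} [Fintype ι] [Fintype κ]
    {s : ι → Γ(T.X₂, U)} {t : κ → Γ(T.X₃, U)} (hs : IsBasisOn T.X₂ U s)
    (ht : IsBasisOn T.X₃ U t) (hg : Function.Surjective (T.g.app U)) {x : X} (hx : x ∈ U) :
    ∃ (V : X.Opens) (n : ℕ) (v : Fin n → Γ(T.X₁, V)), x ∈ V ∧ IsBasisOn T.X₁ V v := by
  have := Module.Finite.of_basis hs.basis
  have := Module.Projective.of_basis hs.basis
  have := Module.Projective.of_basis ht.basis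
  obtain ⟨e⟩ := nonempty_linearEquiv_prod_of_exact (i := sectionsLinearMap T.f U)
    (q := sectionsLinearMap T.g U) (injective_app_of_mono T.f U) (exact_app_of_exact hT U) hg
  have : Module.Finite Γ(X, U) Γ(T.X₁, U) :=
    .of_surjective (LinearMap.fst _ _ _ ∘ₗ e.toLinearMap) (Prod.fst_surjective.comp e.surjective)
  have : Module.Projective Γ(X, U) Γ(T.X₁, U) :=
    .of_split (e.symm.toLinearMap ∘ₗ LinearMap.inl _ _ _) (LinearMap.fst _ _ _ ∘ₗ e.toLinearMap)
      (LinearMap.ext fun m => by simp)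
  obtain ⟨f, n, v, hxf, hv⟩ :=
    (LocalizesOn.of_exact hT (hs.localizesOn hU) (ht.localizesOn hU)).exists_isBasisOn hU hx
  exact ⟨_, n, v, hxf, hv⟩

end Exactness

/-! ### The two structures on the kernel of a transition map -/

/-- Functions on `X`, pulled back along `p` and along `q`, act in the same way on the functions on
`Z'` that vanish on `Z`. -/
def AgreeOnKernel {X Z Z' : Scheme.{u}} (i : Z ⟶ Z') (p q : Z' ⟶ X) : Prop :=
  ∀ ⦃U : X.Opens⦄ ⦃W : Z'.Opens⦄ (h₁ : W ≤ p ⁻¹ᵁ U) (h₂ : W ≤ q ⁻¹ᵁ U) (a : Γ(X, U))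
    (c : Γ(Z', W)), i.app W c = 0 → p.appLE U W h₁ a * c = q.appLE U W h₂ a * c

section Functions

variable {X Y Z : Scheme.{u}}

theorem appLE_comp_app (g : Y ⟶ X) (d : Z ⟶ Y) {U : X.Opens} {W : Y.Opens} (h : W ≤ g ⁻¹ᵁ U) :
    g.appLE U W h ≫ d.app W = (d ≫ g).appLE U (d ⁻¹ᵁ W) (d.preimage_mono h) := by
  rw [Hom.app_eq_appLE, Hom.appLE_comp_appLE]

theorem app_appLE_apply (g : Y ⟶ X) (d : Z ⟶ Y) {U : X.Opens} {W : Y.Opens} (h : W ≤ g ⁻¹ᵁ U)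
    (a : Γ(X, U)) :
    d.app W (g.appLE U W h a) = (d ≫ g).appLE U (d ⁻¹ᵁ W) (d.preimage_mono h) a :=
  ConcreteCategory.congr_hom (appLE_comp_app g d h) a

theorem appLE_sub_appLE_mem_ker {g₁ g₂ : Y ⟶ X} {d : Z ⟶ Y} (hd : d ≫ g₁ = d ≫ g₂) {U : X.Opens}
    {W : Y.Opens} (h₁ : W ≤ g₁ ⁻¹ᵁ U) (h₂ : W ≤ g₂ ⁻¹ᵁ U) (a : Γ(X, U)) :
    g₁.appLE U W h₁ a - g₂.appLE U W h₂ a ∈ RingHom.ker (d.app W).hom := by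
  rw [RingHom.mem_ker, map_sub, sub_eq_zero]
  refine (app_appLE_apply g₁ d h₁ a).trans (Eq.trans ?_ (app_appLE_apply g₂ d h₂ a).symm)
  simp only [hd]

theorem presheaf_map_appLE_apply (g : Y ⟶ X) {U : X.Opens} {V W : Y.Opens} (h : V ≤ g ⁻¹ᵁ U)
    (h' : W ≤ V) (a : Γ(X, U)) :
    Y.presheaf.map (homOfLE h').op (g.appLE U V h a) = g.appLE U W (h'.trans h) a := by
  rw [← CommRingCat.comp_apply, Hom.appLE_map]

theorem subschemeι_comp_eq_of_ker_le {d : Z ⟶ Y} [IsClosedImmersion d]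
    {I : IdealSheafData Y} (hI : d.ker ≤ I) {g₁ g₂ : Y ⟶ X} (h : d ≫ g₁ = d ≫ g₂) :
    I.subschemeι ≫ g₁ = I.subschemeι ≫ g₂ := by
  have hd : d.toImage ≫ d.ker.subschemeι = d := Hom.toImage_imageι d
  have hker : d.ker.subschemeι ≫ g₁ = d.ker.subschemeι ≫ g₂ := by
    rw [← cancel_epi d.toImage, reassoc_of% hd, reassoc_of% hd, h]
  rw [← IdealSheafData.inclusion_subschemeι hI, Category.assoc, Category.assoc, hker]

end Functions

namespace infinitesimalNbhd

open Limits

variable {X S : Scheme.{u}} (f : X ⟶ S) (k : ℕ)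

theorem fst_preimage_eq_snd_preimage (U : X.Opens) : fst f k ⁻¹ᵁ U = snd f k ⁻¹ᵁ U := by
  ext z
  change fst f k z ∈ U ↔ snd f k z ∈ U
  rw [fst_apply_eq_snd_apply]

/-- The closed immersion of the infinitesimal neighbourhood into the open subscheme of `X ×_S X` in
which the diagonal is closed. -/
def toCoborder : infinitesimalNbhd f k ⟶ (pullback.diagonal f).coborderRange.toScheme :=
  ((pullback.diagonal f).liftCoborder.ker ^ (k + 1)).subschemeι

theorem toCoborder_fst : toCoborder f k ≫ (pullback.diagonal f).coborderRange.ι ≫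
    pullback.fst f f = fst f k := (Category.assoc _ _ _).symm

theorem toCoborder_snd : toCoborder f k ≫ (pullback.diagonal f).coborderRange.ι ≫
    pullback.snd f f = snd f k := (Category.assoc _ _ _).symm

instance : IsClosedImmersion (toCoborder f k) :=
  inferInstanceAs (IsClosedImmersion ((pullback.diagonal f).liftCoborder.ker ^ (k + 1)).subschemeι)

theorem ker_toCoborder_app {W : (pullback.diagonal f).coborderRange.toScheme.Opens}
    (hW : IsAffineOpen W) :
    RingHom.ker ((toCoborder f k).app W).hom =
      RingHom.ker ((pullback.diagonal f).liftCoborder.app W).hom ^ (k + 1) := by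
  refine (IdealSheafData.ker_subschemeι_app _ ⟨W, hW⟩).trans ?_
  rw [IdealSheafData.ideal_pow, Pi.pow_apply, Hom.ker_apply]

/-- The closed immersion of an infinitesimal neighbourhood of the diagonal into the next one. -/
def transition : infinitesimalNbhd f k ⟶ infinitesimalNbhd f (k + 1) :=
  IdealSheafData.inclusion fun _ => Ideal.pow_le_pow_right k.succ.le_succ

theorem transition_toCoborder : transition f k ≫ toCoborder f (k + 1) = toCoborder f k :=
  IdealSheafData.inclusion_subschemeι _

theorem transition_fst : transition f k ≫ fst f (k + 1) = fst f k := by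
  rw [← toCoborder_fst, ← toCoborder_fst, ← Category.assoc, transition_toCoborder]

theorem transition_snd : transition f k ≫ snd f (k + 1) = snd f k := by
  rw [← toCoborder_snd, ← toCoborder_snd, ← Category.assoc, transition_toCoborder]

instance : IsClosedImmersion (transition f k) := by
  have : IsClosedImmersion (transition f k ≫ toCoborder f (k + 1)) := by
    rw [transition_toCoborder]
    infer_instance
  exact .of_comp_isClosedImmersion _ (toCoborder f (k + 1))

theorem liftCoborder_fst_eq_liftCoborder_snd :
    (pullback.diagonal f).liftCoborder ≫ (pullback.diagonal f).coborderRange.ι ≫ pullback.fst f f =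
      (pullback.diagonal f).liftCoborder ≫ (pullback.diagonal f).coborderRange.ι ≫
        pullback.snd f f := by
  rw [Hom.liftCoborder_ι_assoc, Hom.liftCoborder_ι_assoc, pullback.diagonal_fst,
    pullback.diagonal_snd]

theorem fst_zero_eq_snd_zero : fst f 0 = snd f 0 := by
  rw [← toCoborder_fst, ← toCoborder_snd]
  exact subschemeι_comp_eq_of_ker_le (pow_one _).ge (liftCoborder_fst_eq_liftCoborder_snd f)

theorem mem_ker_pow_of_transition_app_eq_zero
    {W : (pullback.diagonal f).coborderRange.toScheme.Opens} (hW : IsAffineOpen W)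
    {b : Γ((pullback.diagonal f).coborderRange, W)}
    (hb : (transition f k).app _ ((toCoborder f (k + 1)).app W b) = 0) :
    b ∈ RingHom.ker ((pullback.diagonal f).liftCoborder.app W).hom ^ (k + 1) := by
  rw [← ker_toCoborder_app f k hW, RingHom.mem_ker, ← transition_toCoborder, Hom.comp_app]
  exact hb

-- The difference of the two pullbacks of `a` lies in `I`, and `c` comes from `Iᵏ⁺¹`.
theorem fst_mul_eq_snd_mul_preimage {W : (pullback.diagonal f).coborderRange.toScheme.Opens}
    (hW : IsAffineOpen W) {U : X.Opens}
    (h₁ : W ≤ ((pullback.diagonal f).coborderRange.ι ≫ pullback.fst f f) ⁻¹ᵁ U)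
    (h₂ : W ≤ ((pullback.diagonal f).coborderRange.ι ≫ pullback.snd f f) ⁻¹ᵁ U) (a : Γ(X, U))
    {c : Γ(infinitesimalNbhd f (k + 1), toCoborder f (k + 1) ⁻¹ᵁ W)}
    (hc : (transition f k).app _ c = 0) :
    (fst f (k + 1)).appLE U _ ((toCoborder f (k + 1)).preimage_mono h₁) a * c =
      (snd f (k + 1)).appLE U _ ((toCoborder f (k + 1)).preimage_mono h₂) a * c := by
  obtain ⟨b, rfl⟩ := (toCoborder f (k + 1)).app_surjective W hW c
  have hab := Ideal.mul_mem_mul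
    (appLE_sub_appLE_mem_ker (liftCoborder_fst_eq_liftCoborder_snd f) h₁ h₂ a)
    (mem_ker_pow_of_transition_app_eq_zero f k hW hc)
  rw [← pow_succ', ← ker_toCoborder_app f (k + 1) hW, RingHom.mem_ker, map_mul, map_sub, sub_mul,
    sub_eq_zero] at hab
  refine Eq.trans ?_ (hab.trans ?_)
  · exact congrArg (· * _) (app_appLE_apply _ (toCoborder f (k + 1)) h₁ a).symm
  · exact congrArg (· * _) (app_appLE_apply _ (toCoborder f (k + 1)) h₂ a)

theorem exists_isAffineOpen_toCoborder_preimage_le {V : (infinitesimalNbhd f k).Opens} {U : X.Opens}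
    (h₁ : V ≤ fst f k ⁻¹ᵁ U) (h₂ : V ≤ snd f k ⁻¹ᵁ U) {z : infinitesimalNbhd f k} (hz : z ∈ V) :
    ∃ W : (pullback.diagonal f).coborderRange.toScheme.Opens, IsAffineOpen W ∧
      W ≤ ((pullback.diagonal f).coborderRange.ι ≫ pullback.fst f f) ⁻¹ᵁ U ∧
      W ≤ ((pullback.diagonal f).coborderRange.ι ≫ pullback.snd f f) ⁻¹ᵁ U ∧
      z ∈ toCoborder f k ⁻¹ᵁ W ∧ toCoborder f k ⁻¹ᵁ W ≤ V := by
  obtain ⟨O, rfl⟩ : ∃ O : (pullback.diagonal f).coborderRange.toScheme.Opens,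
      toCoborder f k ⁻¹ᵁ O = V := by
    obtain ⟨t, ht, e⟩ := (toCoborder f k).isEmbedding.isInducing.isOpen_iff.mp V.isOpen
    exact ⟨⟨t, ht⟩, TopologicalSpace.Opens.ext e⟩
  obtain ⟨_, ⟨W, hW, rfl⟩, hzW, hWO⟩ :=
    (pullback.diagonal f).coborderRange.toScheme.isBasis_affineOpens.exists_subset_of_mem_open
      (show toCoborder f k z ∈
          O ⊓ (((pullback.diagonal f).coborderRange.ι ≫ pullback.fst f f) ⁻¹ᵁ U ⊓
            ((pullback.diagonal f).coborderRange.ι ≫ pullback.snd f f) ⁻¹ᵁ U) from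
        ⟨hz, h₁ hz, h₂ hz⟩) (TopologicalSpace.Opens.isOpen _)
  exact ⟨W, hW, fun w hw => (hWO hw).2.1, fun w hw => (hWO hw).2.2, hzW, fun w hw => (hWO hw).1⟩

theorem agreeOnKernel_transition :
    AgreeOnKernel (transition f k) (fst f (k + 1)) (snd f (k + 1)) := by
  intro U V h₁ h₂ a c hc
  refine (infinitesimalNbhd f (k + 1)).IsSheaf.section_ext fun z hz => ?_
  obtain ⟨W, hW, hW₁, hW₂, hzW, hWV⟩ :=
    exists_isAffineOpen_toCoborder_preimage_le f (k + 1) h₁ h₂ hz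
  have hcW : (transition f k).app _ ((infinitesimalNbhd f (k + 1)).presheaf.map
      (homOfLE hWV).op c) = 0 := by
    rw [← CommRingCat.comp_apply, Hom.naturality, CommRingCat.comp_apply, hc, map_zero]
  refine ⟨_, hWV, hzW, ?_⟩
  rw [map_mul, map_mul, presheaf_map_appLE_apply, presheaf_map_appLE_apply]
  exact fst_mul_eq_snd_mul_preimage f k hW hW₁ hW₂ a hcW

end infinitesimalNbhd

/-! ### Functions on the infinitesimal neighbourhoods of the diagonal of an affine chart -/

section FiniteProjective

/-- The ring homomorphism `φ : A → C` makes `C` a finite projective `A`-module. -/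
def IsFiniteProjective {A C : Type*} [CommRing A] [CommRing C] (φ : A →+* C) : Prop :=
  letI := φ.toAlgebra
  Module.Finite A C ∧ Module.Projective A C

theorem isFiniteProjective_algebraMap_iff {A C : Type*} [CommRing A] [CommRing C]
    [inst : Algebra A C] :
    IsFiniteProjective (algebraMap A C) ↔ Module.Finite A C ∧ Module.Projective A C := by
  have h : (algebraMap A C).toAlgebra = inst := Algebra.algebra_ext _ _ fun _ => rfl
  unfold IsFiniteProjective
  rw [h]

theorem IsFiniteProjective.ringEquiv_comp {A C D : Type*} [CommRing A] [CommRing C] [CommRing D]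
    {φ : A →+* C} (h : IsFiniteProjective φ) (e : C ≃+* D) :
    IsFiniteProjective ((e : C →+* D).comp φ) := by
  let _ := φ.toAlgebra
  let _ := ((e : C →+* D).comp φ).toAlgebra
  obtain ⟨_, _⟩ : Module.Finite A C ∧ Module.Projective A C := h
  let e' : C ≃ₗ[A] D := (AlgEquiv.ofRingEquiv (f := e) fun _ => rfl).toLinearEquiv
  exact ⟨.equiv e', .of_equiv' e'⟩

theorem comap_pow_of_bijective {B C : Type*} [CommRing B] [CommRing C] {e : B →+* C}
    (he : Function.Bijective e) (I : Ideal C) (n : ℕ) : (I ^ n).comap e = I.comap e ^ n := by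
  have h (J : Ideal C) : J.comap e = J.map (RingEquiv.ofBijective e he).symm :=
    (Ideal.map_symm (RingEquiv.ofBijective e he)).symm
  rw [h, h, Ideal.map_pow]

theorem IsDifferentiallySmoothAlgebra.isFiniteProjective {R A : Type u} {C : Type*} [CommRing R]
    [CommRing A] [Algebra R A] [CommRing C] (h : IsDifferentiallySmoothAlgebra R A)
    {ρ : A ⊗[R] A →+* C} (hρ : Function.Surjective ρ) {n : ℕ}
    (hn : RingHom.ker ρ = KaehlerDifferential.ideal R A ^ n) :
    IsFiniteProjective (ρ.comp Algebra.TensorProduct.includeLeftRingHom) := by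
  exact (isFiniteProjective_algebraMap_iff.2 (h.finite_projective_quotient_pow n)).ringEquiv_comp
    ((Ideal.quotEquivOfEq hn.symm).trans (RingHom.quotientKerEquivOfSurjective hρ))

theorem ringHom_eq_lmul' {R A : Type*} [CommRing R] [CommRing A] [Algebra R A]
    {δ : A ⊗[R] A →+* A} (h₁ : δ.comp Algebra.TensorProduct.includeLeftRingHom = RingHom.id A)
    (h₂ : δ.comp (Algebra.TensorProduct.includeRight : A →ₐ[R] A ⊗[R] A).toRingHom = RingHom.id A) :
    δ = (Algebra.TensorProduct.lmul' R : A ⊗[R] A →ₐ[R] A).toRingHom := by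
  apply Algebra.TensorProduct.ringHom_ext
  · rw [h₁]
    ext a
    simp
  · refine h₂.trans ?_
    ext a
    simp

theorem IsDifferentiallySmoothAlgebra.isFiniteProjective_of_isPushout
    {R A T C : CommRingCat.{u}} {φ : R ⟶ A}
    (h : letI := φ.hom.toAlgebra; IsDifferentiallySmoothAlgebra R A)
    {i₁ i₂ : A ⟶ T} (hT : IsPushout φ φ i₁ i₂) {δ : T ⟶ A} (h₁ : i₁ ≫ δ = 𝟙 A)
    (h₂ : i₂ ≫ δ = 𝟙 A) {ρ : T ⟶ C} (hρ : Function.Surjective ρ.hom) {n : ℕ}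
    (hn : RingHom.ker ρ.hom = RingHom.ker δ.hom ^ n) :
    IsFiniteProjective (i₁ ≫ ρ).hom := by
  let _ := φ.hom.toAlgebra
  have hp := CommRingCat.isPushout_tensorProduct R A A
  let e := hp.isoIsPushout _ _ hT
  have he₁ : _ ≫ e.hom = i₁ := IsPushout.inl_isoIsPushout_hom _ _ hp hT
  have he₂ : _ ≫ e.hom = i₂ := IsPushout.inr_isoIsPushout_hom _ _ hp hT
  have he : Function.Bijective e.hom.hom := ConcreteCategory.bijective_of_isIso e.hom
  have hδ : (e.hom ≫ δ).hom = (Algebra.TensorProduct.lmul' R : A ⊗[R] A →ₐ[R] A).toRingHom :=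
    ringHom_eq_lmul' (congrArg CommRingCat.Hom.hom ((Category.assoc _ _ _).symm.trans
      ((congrArg (· ≫ δ) he₁).trans h₁))) (congrArg CommRingCat.Hom.hom
        ((Category.assoc _ _ _).symm.trans ((congrArg (· ≫ δ) he₂).trans h₂)))
  have hker : RingHom.ker (e.hom ≫ ρ).hom = KaehlerDifferential.ideal R A ^ n := calc
    _ = (RingHom.ker δ.hom ^ n).comap e.hom.hom := by
      rw [← hn, CommRingCat.hom_comp, RingHom.comap_ker]
    _ = RingHom.ker (e.hom ≫ δ).hom ^ n := by
      rw [comap_pow_of_bijective he, CommRingCat.hom_comp, RingHom.comap_ker]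
    _ = KaehlerDifferential.ideal R A ^ n := by
      rw [hδ]
      rfl
  have hs : Function.Surjective (e.hom ≫ ρ).hom := by
    rw [CommRingCat.hom_comp]
    exact hρ.comp he.2
  have hfp := h.isFiniteProjective hs hker
  rw [← he₁]
  exact hfp

end FiniteProjective

section Sections

variable {X Y : Scheme.{u}} (g : X ⟶ Y) {U : X.Opens} {W : Y.Opens}

theorem le_coborderRange_of_surjective [IsImmersion g] (hW : IsAffineOpen W)
    (hW' : IsAffineOpen (g ⁻¹ᵁ W)) (h : Function.Surjective (g.app W)) : W ≤ g.coborderRange := by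
  have : IsAffine W.toScheme := hW
  have : IsAffine (g ⁻¹ᵁ W).toScheme := hW'
  have happ : Function.Surjective (g.app (W.ι ''ᵁ ⊤)) := by rwa [W.ι_image_top]
  have hc : IsClosedImmersion (g ∣_ W) := by
    refine .of_surjective_of_isAffine _ ?_
    rw [morphismRestrict_appTop]
    exact (ConcreteCategory.bijective_of_isIso (X.presheaf.map _)).2.comp happ
  have hr : Set.range (g ∣_ W) = W.ι ⁻¹' Set.range g := by
    rw [morphismRestrict_base]
    exact Set.range_restrictPreimage _ _
  intro w hw
  have hw' : (⟨w, hw⟩ : W) ∈ W.ι ⁻¹' coborder (Set.range g) := by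
    rw [← W.ι.isOpenEmbedding.coborder_preimage, ← hr,
      (g ∣_ W).isClosedEmbedding.isClosed_range.coborder_eq]
    trivial
  exact hw'

theorem appLE_comp_appLE_of_comp_eq_id {g : X ⟶ Y} {p : Y ⟶ X} (h : g ≫ p = 𝟙 X)
    (hp : W ≤ p ⁻¹ᵁ U) (hg : U ≤ g ⁻¹ᵁ W) : p.appLE U W hp ≫ g.appLE W U hg = 𝟙 _ := by
  rw [Hom.appLE_comp_appLE]
  simp only [h]
  exact (Category.id_comp _).trans (X.presheaf.map_id _)

theorem ker_appLE_of_preimage_eq (h : g ⁻¹ᵁ W = U) :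
    RingHom.ker (g.appLE W U h.ge).hom = RingHom.ker (g.app W).hom := by
  subst h
  rw [Hom.appLE_eq_app]

theorem surjective_app_of_preimage_eq (h : g ⁻¹ᵁ W = U)
    (hs : Function.Surjective (g.appLE W U h.ge)) : Function.Surjective (g.app W) := by
  subst h
  rwa [Hom.appLE_eq_app] at hs

theorem isFiniteProjective_app_of_preimage_eq (h : g ⁻¹ᵁ W = U)
    (hg : IsFiniteProjective (g.appLE W U h.ge).hom) : IsFiniteProjective (g.app W).hom := by
  subst h
  rwa [Hom.appLE_eq_app] at hg

end Sections

namespace infinitesimalNbhd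

open Limits

variable {X S : Scheme.{u}}

/-- The open subscheme `U ×_S U` of `X ×_S X`. -/
abbrev square (f : X ⟶ S) (U : X.Opens) : (pullback f f).Opens :=
  pullback.fst f f ⁻¹ᵁ U ⊓ pullback.snd f f ⁻¹ᵁ U

variable {f : X ⟶ S} {V : S.Opens} {U : X.Opens}

theorem diagonal_preimage_square : pullback.diagonal f ⁻¹ᵁ square f U = U := by
  rw [square, Hom.preimage_inf, ← Hom.comp_preimage, ← Hom.comp_preimage, pullback.diagonal_fst,
    pullback.diagonal_snd, Hom.id_preimage, inf_idem]

theorem ι_preimage_square (k : ℕ) : ι f k ⁻¹ᵁ square f U = fst f k ⁻¹ᵁ U :=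
  (inf_eq_left.mpr (fst_preimage_eq_snd_preimage f k U).le : fst f k ⁻¹ᵁ U ⊓ snd f k ⁻¹ᵁ U = _)

theorem appLE_fst_diagonal : (pullback.fst f f).appLE U (square f U) inf_le_left ≫
    (pullback.diagonal f).appLE (square f U) U diagonal_preimage_square.ge = 𝟙 _ :=
  appLE_comp_appLE_of_comp_eq_id (pullback.diagonal_fst f) _ _

theorem appLE_snd_diagonal : (pullback.snd f f).appLE U (square f U) inf_le_right ≫
    (pullback.diagonal f).appLE (square f U) U diagonal_preimage_square.ge = 𝟙 _ :=
  appLE_comp_appLE_of_comp_eq_id (pullback.diagonal_snd f) _ _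

theorem surjective_diagonal_app_square :
    Function.Surjective ((pullback.diagonal f).app (square f U)) :=
  surjective_app_of_preimage_eq _ diagonal_preimage_square fun a =>
    ⟨_, ConcreteCategory.congr_hom (appLE_fst_diagonal (f := f) (U := U)) a⟩

variable (e : U ≤ f ⁻¹ᵁ V) (hV : IsAffineOpen V) (hU : IsAffineOpen U)
include e hV hU

theorem isAffineOpen_square : IsAffineOpen (square f U) := by
  have : IsAffine _ := hV
  have : IsAffine _ := hU
  exact .of_isIso (Hom.isPullback_resLE (IsPullback.of_hasPullback f f) e e rfl).isoPullback.hom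

theorem isPushout_square : IsPushout (f.appLE V U e) (f.appLE V U e)
    ((pullback.fst f f).appLE U (square f U) inf_le_left)
    ((pullback.snd f f).appLE U (square f U) inf_le_right) :=
  (isIso_pushoutSection_iff (IsPullback.of_hasPullback f f) e e rfl).mp
    (isIso_pushoutSection_of_isAffineOpen (IsPullback.of_hasPullback f f) e e rfl hV hU hU)

theorem square_le_opensRange :
    square f U ≤ (pullback.diagonal f).coborderRange.ι.opensRange := by
  rw [Opens.opensRange_ι]
  exact le_coborderRange_of_surjective _ (isAffineOpen_square e hV hU)
    (diagonal_preimage_square.symm ▸ hU) surjective_diagonal_app_square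

theorem isAffineOpen_coborderRange_preimage_square :
    IsAffineOpen ((pullback.diagonal f).coborderRange.ι ⁻¹ᵁ square f U) :=
  (isAffineOpen_square e hV hU).preimage_of_isOpenImmersion _ (square_le_opensRange e hV hU)

theorem bijective_coborderRange_ι_app_square :
    Function.Bijective ((pullback.diagonal f).coborderRange.ι.app (square f U)).hom := by
  have := (pullback.diagonal f).coborderRange.ι.isIso_app _ (square_le_opensRange e hV hU)
  exact ConcreteCategory.bijective_of_isIso _

theorem isAffineOpen_fst_preimage (k : ℕ) : IsAffineOpen (fst f k ⁻¹ᵁ U) := by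
  rw [← ι_preimage_square]
  exact (isAffineOpen_coborderRange_preimage_square e hV hU).preimage (toCoborder f k)

theorem surjective_ι_app_square (k : ℕ) : Function.Surjective ((ι f k).app (square f U)).hom :=
  ((toCoborder f k).app_surjective _ (isAffineOpen_coborderRange_preimage_square e hV hU)).comp
    (bijective_coborderRange_ι_app_square e hV hU).2

theorem ker_ι_app_square (k : ℕ) : RingHom.ker ((ι f k).app (square f U)).hom =
    RingHom.ker ((pullback.diagonal f).appLE (square f U) U
      diagonal_preimage_square.ge).hom ^ (k + 1) := by
  let o := (pullback.diagonal f).coborderRange.ι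
  let d := (pullback.diagonal f).liftCoborder
  have hdiag : RingHom.ker ((d ≫ o).app (square f U)).hom =
      RingHom.ker ((pullback.diagonal f).app (square f U)).hom := by
    rw [Hom.liftCoborder_ι]
  calc
    _ = (RingHom.ker ((toCoborder f k).app (o ⁻¹ᵁ square f U)).hom).comap
        (o.app (square f U)).hom := rfl
    _ = RingHom.ker ((d ≫ o).app (square f U)).hom ^ (k + 1) := by
      rw [ker_toCoborder_app f k (isAffineOpen_coborderRange_preimage_square e hV hU),
        comap_pow_of_bijective (bijective_coborderRange_ι_app_square e hV hU)]
      rfl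
    _ = _ := by
      rw [hdiag, ker_appLE_of_preimage_eq _ diagonal_preimage_square]

variable (h : letI := (f.appLE V U e).hom.toAlgebra; IsDifferentiallySmoothAlgebra Γ(S, V) Γ(X, U))
include h

theorem isFiniteProjective_fst_app (k : ℕ) : IsFiniteProjective ((fst f k).app U).hom := by
  have hfp := h.isFiniteProjective_of_isPushout (isPushout_square e hV hU) appLE_fst_diagonal
    appLE_snd_diagonal (surjective_ι_app_square e hV hU k) (ker_ι_app_square e hV hU k)
  rw [appLE_comp_app] at hfp
  exact isFiniteProjective_app_of_preimage_eq _ (ι_preimage_square k).symm hfp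

theorem isFiniteProjective_snd_app (k : ℕ) : IsFiniteProjective ((snd f k).app U).hom := by
  have hfp := h.isFiniteProjective_of_isPushout (isPushout_square e hV hU).flip appLE_snd_diagonal
    appLE_fst_diagonal (surjective_ι_app_square e hV hU k) (ker_ι_app_square e hV hU k)
  rw [appLE_comp_app] at hfp
  exact isFiniteProjective_app_of_preimage_eq _
    ((ι_preimage_square k).trans (fst_preimage_eq_snd_preimage f k U)).symm hfp

end infinitesimalNbhd

/-! ### Direct images of the kernel of a transition map -/

section Transition

variable {X Z Z' : Scheme.{u}}

/-- The canonical morphism `q^* E ⟶ i_* (i ≫ q)^* E`. -/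
def pullbackToPushforward (i : Z ⟶ Z') (q : Z' ⟶ X) (E : X.Modules) :
    (Modules.pullback q).obj E ⟶
      (Modules.pushforward i).obj ((Modules.pullback (i ≫ q)).obj E) :=
  ((Modules.pullbackPushforwardAdjunction q).homEquiv E
    ((Modules.pushforward i).obj ((Modules.pullback (i ≫ q)).obj E))).symm
      ((Modules.pullbackPushforwardAdjunction (i ≫ q)).unit.app E)

theorem pullbackToPushforward_app_pullbackSection (i : Z ⟶ Z') (q : Z' ⟶ X) {E : X.Modules}
    {U : X.Opens} (s : Γ(E, U)) :
    (pullbackToPushforward i q E).app (q ⁻¹ᵁ U) (pullbackSection q s) =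
      pullbackSection (i ≫ q) s := by
  have hunit := ((Modules.pullbackPushforwardAdjunction q).homEquiv E
    ((Modules.pushforward i).obj ((Modules.pullback (i ≫ q)).obj E))).apply_symm_apply
      ((Modules.pullbackPushforwardAdjunction (i ≫ q)).unit.app E)
  rw [Adjunction.homEquiv_unit] at hunit
  exact congrArg (fun ψ : E ⟶ (Modules.pushforward (i ≫ q)).obj
    ((Modules.pullback (i ≫ q)).obj E) => ψ.app U s) hunit

/-- Locally over `X`, the morphism `φ : F' ⟶ i_* F` takes some basis of `F'` to a basis of `F`. If
`i` is a closed immersion, this says that `φ` exhibits `F` as the restriction of the locally free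
module `F'`. -/
def CarriesLocalBases (r : Z' ⟶ X) {i : Z ⟶ Z'} {F' : Z'.Modules} {F : Z.Modules}
    (φ : F' ⟶ (Modules.pushforward i).obj F) : Prop :=
  ∀ x : X, ∃ (U : X.Opens) (n : ℕ) (t : Fin n → Γ(F', r ⁻¹ᵁ U)), x ∈ U ∧
    IsBasisOn F' (r ⁻¹ᵁ U) t ∧ IsBasisOn F (i ⁻¹ᵁ r ⁻¹ᵁ U) fun j => φ.app (r ⁻¹ᵁ U) (t j)

theorem carriesLocalBases_pullbackToPushforward (i : Z ⟶ Z') (q : Z' ⟶ X) {E : X.Modules}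
    (hE : IsLocallyFreeOfFiniteRank E) : CarriesLocalBases q (pullbackToPushforward i q E) := by
  intro x
  obtain ⟨U, n, s, hx, hs⟩ := hE.exists_isBasisOn x
  refine ⟨U, n, _, hx, hs.pullback q, ?_⟩
  simp_rw [pullbackToPushforward_app_pullbackSection]
  exact hs.pullback (i ≫ q)

theorem CarriesLocalBases.of_preimage_eq {p q : Z' ⟶ X} (hpq : ∀ U, p ⁻¹ᵁ U = q ⁻¹ᵁ U)
    {i : Z ⟶ Z'} {F' : Z'.Modules} {F : Z.Modules} {φ : F' ⟶ (Modules.pushforward i).obj F}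
    (hφ : CarriesLocalBases q φ) : CarriesLocalBases p φ := by
  intro x
  obtain ⟨U, h⟩ := hφ x
  refine ⟨U, ?_⟩
  rwa [hpq]

theorem CarriesLocalBases.exists_isAffineOpen_le {r : Z' ⟶ X} {i : Z ⟶ Z'} {F' : Z'.Modules}
    {F : Z.Modules} {φ : F' ⟶ (Modules.pushforward i).obj F} (hφ : CarriesLocalBases r φ)
    {O : X.Opens} {x : X} (hx : x ∈ O) :
    ∃ (U : X.Opens) (n : ℕ) (t : Fin n → Γ(F', r ⁻¹ᵁ U)), x ∈ U ∧ U ≤ O ∧ IsAffineOpen U ∧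
      IsBasisOn F' (r ⁻¹ᵁ U) t ∧
        IsBasisOn F (i ⁻¹ᵁ r ⁻¹ᵁ U) fun j => φ.app (r ⁻¹ᵁ U) (t j) := by
  obtain ⟨V, n, t, hxV, ht, ht'⟩ := hφ x
  obtain ⟨_, ⟨U, hU, rfl⟩, hxU, hUV : U ≤ V ⊓ O⟩ :=
    X.isBasis_affineOpens.exists_subset_of_mem_open (show x ∈ V ⊓ O from ⟨hxV, hx⟩) (V ⊓ O).isOpen
  have hUV' : U ≤ V := hUV.trans inf_le_left
  refine ⟨U, n, _, hxU, hUV.trans inf_le_right, hU, ht.restrict (r.preimage_mono hUV'), ?_⟩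
  simp_rw [app_presheaf_map]
  exact ht'.restrict (i.preimage_mono (r.preimage_mono hUV'))

theorem surjective_app_of_isBasisOn {i : Z ⟶ Z'} [IsClosedImmersion i] {F' : Z'.Modules}
    {F : Z.Modules} (φ : F' ⟶ (Modules.pushforward i).obj F) {V : Z'.Opens} (hV : IsAffineOpen V)
    {ι : Type*} [Fintype ι] (t : ι → Γ(F', V))
    (ht : IsBasisOn F (i ⁻¹ᵁ V) fun j => φ.app V (t j)) : Function.Surjective (φ.app V) := by
  intro m
  obtain ⟨c, hc⟩ := (ht _ le_rfl).2 m
  choose d hd using fun j => i.app_surjective V hV (c j)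
  refine ⟨∑ j, d j • F'.presheaf.map (homOfLE le_rfl).op (t j),
    (app_sum_smul φ le_rfl t d).trans (Eq.trans ?_ hc)⟩
  simp_rw [← hd]
  rfl

theorem smul_eq_smul_of_isBasisOn {i : Z ⟶ Z'} {F' : Z'.Modules} {F : Z.Modules}
    (φ : F' ⟶ (Modules.pushforward i).obj F) {V : Z'.Opens} {ι : Type*} [Fintype ι]
    {t : ι → Γ(F', V)} (ht : IsBasisOn F' V t)
    (ht' : IsBasisOn F (i ⁻¹ᵁ V) fun j => φ.app V (t j)) {W : Z'.Opens} (hW : W ≤ V)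
    {a b : Γ(Z', W)} (hab : ∀ c : Γ(Z', W), i.app W c = 0 → a * c = b * c) (m : Γ(F', W))
    (hm : φ.app W m = 0) : a • m = b • m := by
  obtain ⟨c, rfl⟩ := (ht W hW).2 m
  dsimp only at hm ⊢
  rw [app_sum_smul] at hm
  have hc : (fun j => i.app W (c j)) = 0 := by
    refine (ht' (i ⁻¹ᵁ W) (i.preimage_mono hW)).1 (Eq.trans ?_ (hm.trans ?_))
    · rfl
    · simp only [Pi.zero_apply, zero_smul, Finset.sum_const_zero]
      rfl
  simp_rw [Finset.smul_sum, smul_smul, fun j => hab _ (congrFun hc j)]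

theorem CarriesLocalBases.appLE_smul_eq_appLE_smul_kernel {p q : Z' ⟶ X} {i : Z ⟶ Z'}
    {F' : Z'.Modules} {F : Z.Modules} {φ : F' ⟶ (Modules.pushforward i).obj F}
    (hφ : CarriesLocalBases p φ) (hi : AgreeOnKernel i p q) {U : X.Opens} {W : Z'.Opens}
    (h₁ : W ≤ p ⁻¹ᵁ U) (h₂ : W ≤ q ⁻¹ᵁ U) (a : Γ(X, U)) (m : Γ(Limits.kernel φ, W)) :
    p.appLE U W h₁ a • m = q.appLE U W h₂ a • m := by
  refine section_ext _ fun z hz => ?_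
  obtain ⟨U', n, t, hzU', ht, ht'⟩ := hφ (p z)
  have hW : W ⊓ p ⁻¹ᵁ U' ≤ W := inf_le_left
  refine ⟨W ⊓ p ⁻¹ᵁ U', hW, ⟨hz, hzU'⟩, injective_app_of_mono (Limits.kernel.ι φ) _ ?_⟩
  rw [Modules.map_smul, Modules.map_smul, Modules.Hom.app_smul, Modules.Hom.app_smul,
    presheaf_map_appLE_apply, presheaf_map_appLE_apply]
  refine smul_eq_smul_of_isBasisOn φ ht ht' inf_le_right
    (hi (hW.trans h₁) (hW.trans h₂) a) _ ?_
  exact congrArg (fun ψ : Limits.kernel φ ⟶ (Modules.pushforward i).obj F => ψ.app _ _)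
    (Limits.kernel.condition φ)

theorem nonempty_pushforward_iso (p q : Z ⟶ X) (hpq : ∀ U, p ⁻¹ᵁ U = q ⁻¹ᵁ U) (K : Z.Modules)
    (hK : ∀ {U : X.Opens} {W : Z.Opens} (h₁ : W ≤ p ⁻¹ᵁ U) (h₂ : W ≤ q ⁻¹ᵁ U) (a : Γ(X, U))
      (m : Γ(K, W)), p.appLE U W h₁ a • m = q.appLE U W h₂ a • m) :
    Nonempty ((Modules.pushforward p).obj K ≅ (Modules.pushforward q).obj K) := by
  let φ : ((Modules.pushforward p).obj K).presheaf ⟶ ((Modules.pushforward q).obj K).presheaf :=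
    { app U := K.presheaf.map (homOfLE (hpq U.unop).ge).op
      naturality U V f := by
        change K.presheaf.map _ ≫ K.presheaf.map _ = K.presheaf.map _ ≫ K.presheaf.map _
        rw [← Functor.map_comp, ← Functor.map_comp]
        rfl }
  have hlin (U : X.Opens) (a : Γ(X, U)) (m : Γ(K, p ⁻¹ᵁ U)) :
      K.presheaf.map (homOfLE (hpq U).ge).op (p.app U a • m) =
        q.app U a • K.presheaf.map (homOfLE (hpq U).ge).op m := by
    rw [Hom.app_eq_appLE, Hom.app_eq_appLE, hK le_rfl (hpq U).le, Modules.map_smul,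
      presheaf_map_appLE_apply]
  let ψ : (Modules.pushforward p).obj K ⟶ (Modules.pushforward q).obj K :=
    ⟨PresheafOfModules.homMk φ fun U => hlin U.unop⟩
  have : IsIso ψ := isIso_of_bijective_app _ fun W => by
    have : IsIso (K.presheaf.map (homOfLE (hpq W).ge).op) := by
      rw [show homOfLE (hpq W).ge = eqToHom (hpq W).symm from rfl]
      infer_instance
    exact ConcreteCategory.bijective_of_isIso (K.presheaf.map (homOfLE (hpq W).ge).op)
  exact ⟨asIso ψ⟩

end Transition

/-! ### Finite locally free morphisms -/

/-- An affine morphism `r` such that `r_* 𝒪` is locally free of finite rank. -/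
structure IsFiniteLocallyFree {X Y : Scheme.{u}} (r : Y ⟶ X) : Prop where
  isAffineHom : IsAffineHom r
  isLocallyFreeOfFiniteRank :
    IsLocallyFreeOfFiniteRank ((Modules.pushforward r).obj (unitModule Y))

namespace IsFiniteLocallyFree

variable {X Y : Scheme.{u}}

theorem of_isFiniteProjective (r : Y ⟶ X)
    (h : ∀ x : X, ∃ U : X.Opens, x ∈ U ∧ IsAffineOpen U ∧ IsAffineOpen (r ⁻¹ᵁ U) ∧
      IsFiniteProjective (r.app U).hom) : IsFiniteLocallyFree r where
  isAffineHom := isAffineHom_of_forall_exists_isAffineOpen r fun x => by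
    obtain ⟨U, hx, hU, hU', -⟩ := h x
    exact ⟨U, hx, hU, hU'⟩
  isLocallyFreeOfFiniteRank := isLocallyFreeOfFiniteRank_of_isBasisOn fun x => by
    obtain ⟨U, hx, hU, hU', h₁, h₂⟩ := h x
    have : Module.Finite Γ(X, U) Γ((Modules.pushforward r).obj (unitModule Y), U) := h₁
    have : Module.Projective Γ(X, U) Γ((Modules.pushforward r).obj (unitModule Y), U) := h₂
    obtain ⟨a, n, s, hxa, hs⟩ :=
      ((localizesOn_unitModule hU').pushforward r).exists_isBasisOn hU hx
    exact ⟨_, _, inferInstance, s, hxa, hs⟩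

theorem isLocallyFreeOfFiniteRank_pushforward {r : Y ⟶ X} (hr : IsFiniteLocallyFree r)
    {F : Y.Modules} (hF : ∀ x : X, ∃ (U : X.Opens) (n : ℕ) (t : Fin n → Γ(F, r ⁻¹ᵁ U)),
      x ∈ U ∧ IsBasisOn F (r ⁻¹ᵁ U) t) :
    IsLocallyFreeOfFiniteRank ((Modules.pushforward r).obj F) :=
  isLocallyFreeOfFiniteRank_of_isBasisOn fun x => by
    obtain ⟨U, m, b, hxU, hb⟩ := hr.isLocallyFreeOfFiniteRank.exists_isBasisOn x
    obtain ⟨V, n, t, hxV, ht⟩ := hF x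
    exact ⟨U ⊓ V, _, inferInstance, _, ⟨hxU, hxV⟩, (hb.restrict inf_le_left).pushforward r
      (ht.restrict (r.preimage_mono inf_le_right))⟩

theorem isLocallyFreeOfFiniteRank_pushforward_pullback {p q : Y ⟶ X}
    (hp : IsFiniteLocallyFree p) (hpq : ∀ U, p ⁻¹ᵁ U = q ⁻¹ᵁ U) {E : X.Modules}
    (hE : IsLocallyFreeOfFiniteRank E) :
    IsLocallyFreeOfFiniteRank ((Modules.pushforward p).obj ((Modules.pullback q).obj E)) :=
  hp.isLocallyFreeOfFiniteRank_pushforward fun x => by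
    obtain ⟨U, n, s, hx, hs⟩ := hE.exists_isBasisOn x
    refine ⟨U, n, ?_⟩
    rw [hpq]
    exact ⟨_, hx, hs.pullback q⟩

end IsFiniteLocallyFree

/-! ### Classes in the Grothendieck group -/

section Classes

variable {X Z Z' : Scheme.{u}}

theorem IsLocallyFreeOfFiniteRank.of_iso {M N : X.Modules} (e : M ≅ N)
    (hM : IsLocallyFreeOfFiniteRank M) : IsLocallyFreeOfFiniteRank N := by
  intro x
  obtain ⟨U, n, hx, ⟨ψ⟩⟩ := hM x
  exact ⟨U, n, hx, ⟨(Modules.restrictFunctor U.ι).mapIso e.symm ≪≫ ψ⟩⟩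

theorem KGroup.mk_eq_add {T : ShortComplex X.Modules} (hT : T.ShortExact)
    (h₁ : IsLocallyFreeOfFiniteRank T.X₁) (h₂ : IsLocallyFreeOfFiniteRank T.X₂)
    (h₃ : IsLocallyFreeOfFiniteRank T.X₃) : mk T.X₂ h₂ = mk T.X₁ h₁ + mk T.X₃ h₃ := by
  have hrel := (QuotientAddGroup.eq_zero_iff _).2
    (AddSubgroup.subset_closure (k := exactSequenceRelations X) ⟨T, hT, h₁, h₂, h₃, rfl⟩)
  rw [QuotientAddGroup.mk_sub, QuotientAddGroup.mk_sub, sub_sub, sub_eq_zero] at hrel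
  exact hrel

theorem isLocallyFreeOfFiniteRank_of_isZero {M : X.Modules} (hM : Limits.IsZero M) :
    IsLocallyFreeOfFiniteRank M :=
  isLocallyFreeOfFiniteRank_of_isBasisOn fun x => by
    have hsub (W : X.Opens) : Subsingleton Γ(M, W) :=
      AddCommGrpCat.subsingleton_of_isZero ((sectionsFunctor W).map_isZero hM)
    exact ⟨⊤, Empty, inferInstance, Empty.elim, trivial, fun W _ =>
      ⟨Function.injective_of_subsingleton _, fun m => ⟨0, Subsingleton.elim _ _⟩⟩⟩

open scoped ZeroObject in
theorem KGroup.mk_eq_of_iso {M N : X.Modules} (e : M ≅ N) (hM : IsLocallyFreeOfFiniteRank M)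
    (hN : IsLocallyFreeOfFiniteRank N) : mk M hM = mk N hN := by
  have h₀ := isLocallyFreeOfFiniteRank_of_isZero (Limits.isZero_zero X.Modules)
  have hadd {M N : X.Modules} (e : M ≅ N) (hM : IsLocallyFreeOfFiniteRank M)
      (hN : IsLocallyFreeOfFiniteRank N) : mk M hM = mk 0 h₀ + mk N hN := by
    let T : ShortComplex X.Modules := ⟨(0 : 0 ⟶ M), e.hom, Limits.zero_comp⟩
    have hg : IsIso T.g := inferInstanceAs (IsIso e.hom)
    have hT : T.ShortExact :=
      { exact := (ShortComplex.exact_iff_mono T rfl).2 inferInstance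
        mono_f := inferInstanceAs (Mono (0 : (0 : X.Modules) ⟶ M)) }
    exact mk_eq_add hT h₀ hM hN
  rw [hadd e hM hN, left_eq_add.1 (hadd (Iso.refl 0) h₀ h₀), zero_add]

/-- Both modules are locally free of finite rank, and they have the same class in `K(X)`. -/
def KGroup.SameClass (M N : X.Modules) : Prop :=
  ∃ (hM : IsLocallyFreeOfFiniteRank M) (hN : IsLocallyFreeOfFiniteRank N), mk M hM = mk N hN

namespace CarriesLocalBases

variable {r : Z' ⟶ X} {i : Z ⟶ Z'} [IsClosedImmersion i] {F' : Z'.Modules} {F : Z.Modules}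
  {φ : F' ⟶ (Modules.pushforward i).obj F}

theorem shortExact_pushforward (hφ : CarriesLocalBases r φ) [IsAffineHom r] :
    ((ShortComplex.mk (Limits.kernel.ι φ) φ (Limits.kernel.condition φ)).map
      (Modules.pushforward r)).ShortExact where
  exact :=
    (ShortComplex.exact_of_f_is_kernel _ (Limits.kernelIsKernel φ)).map_of_mono_of_preservesKernel
      (Modules.pushforward r) (inferInstanceAs (Mono (Limits.kernel.ι φ))) inferInstance
  mono_f := inferInstanceAs (Mono ((Modules.pushforward r).map (Limits.kernel.ι φ)))
  epi_g := epi_of_locally_surjective _ fun O m x hx => by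
    obtain ⟨U, n, t, hxU, hUO, hU, -, ht⟩ := hφ.exists_isAffineOpen_le hx
    obtain ⟨m', hm'⟩ := surjective_app_of_isBasisOn φ (hU.preimage r) t ht
      (((Modules.pushforward r).obj ((Modules.pushforward i).obj F)).presheaf.map
        (homOfLE hUO).op m)
    exact ⟨U, hUO, m', hxU, hm'⟩

theorem isLocallyFreeOfFiniteRank_pushforward_kernel (hφ : CarriesLocalBases r φ)
    [IsAffineHom r] (h₂ : IsLocallyFreeOfFiniteRank ((Modules.pushforward r).obj F'))
    (h₃ : IsLocallyFreeOfFiniteRank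
      ((Modules.pushforward r).obj ((Modules.pushforward i).obj F))) :
    IsLocallyFreeOfFiniteRank ((Modules.pushforward r).obj (Limits.kernel φ)) :=
  isLocallyFreeOfFiniteRank_of_isBasisOn fun x => by
    obtain ⟨V₂, n₂, s₂, hx₂, hs₂⟩ := h₂.exists_isBasisOn x
    obtain ⟨V₃, n₃, s₃, hx₃, hs₃⟩ := h₃.exists_isBasisOn x
    obtain ⟨U, n, t, hxU, hUO, hU, -, ht⟩ :=
      hφ.exists_isAffineOpen_le (show x ∈ V₂ ⊓ V₃ from ⟨hx₂, hx₃⟩)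
    have hexact := hφ.shortExact_pushforward
    have := hexact.mono_f
    obtain ⟨V, m, v, hxV, hv⟩ := IsBasisOn.exists_isBasisOn_of_exact hexact.exact hU
      (hs₂.restrict (hUO.trans inf_le_left)) (hs₃.restrict (hUO.trans inf_le_right))
      (surjective_app_of_isBasisOn φ (hU.preimage r) t ht) hxU
    exact ⟨V, _, inferInstance, v, hxV, hv⟩

theorem exists_mk_pushforward_eq_add (hφ : CarriesLocalBases r φ) (hr : IsFiniteLocallyFree r)
    (h₃ : IsLocallyFreeOfFiniteRank ((Modules.pushforward (i ≫ r)).obj F)) :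
    ∃ (h₁ : IsLocallyFreeOfFiniteRank ((Modules.pushforward r).obj (Limits.kernel φ)))
      (h₂ : IsLocallyFreeOfFiniteRank ((Modules.pushforward r).obj F')),
      KGroup.mk _ h₂ = KGroup.mk _ h₁ + KGroup.mk _ h₃ := by
  have := hr.isAffineHom
  have h₂ : IsLocallyFreeOfFiniteRank ((Modules.pushforward r).obj F') :=
    hr.isLocallyFreeOfFiniteRank_pushforward fun x => by
      obtain ⟨U, n, t, hx, ht, -⟩ := hφ x
      exact ⟨U, n, t, hx, ht⟩
  let e := (Modules.pushforwardComp i r).app F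
  have h₁ := hφ.isLocallyFreeOfFiniteRank_pushforward_kernel h₂ (h₃.of_iso e.symm)
  refine ⟨h₁, h₂, (KGroup.mk_eq_add hφ.shortExact_pushforward h₁ h₂ (h₃.of_iso e.symm)).trans ?_⟩
  exact congrArg _ (KGroup.mk_eq_of_iso e _ h₃)

end CarriesLocalBases

theorem KGroup.SameClass.pushforward_pullback {i : Z ⟶ Z'} [IsClosedImmersion i] {p q : Z' ⟶ X}
    {p₀ q₀ : Z ⟶ X} (hp₀ : i ≫ p = p₀) (hq₀ : i ≫ q = q₀) (hp : IsFiniteLocallyFree p)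
    (hq : IsFiniteLocallyFree q) (hpq : ∀ U, p ⁻¹ᵁ U = q ⁻¹ᵁ U) (hi : AgreeOnKernel i p q)
    {E : X.Modules} (hE : IsLocallyFreeOfFiniteRank E)
    (h₀ : SameClass ((Modules.pushforward p₀).obj ((Modules.pullback q₀).obj E))
      ((Modules.pushforward q₀).obj ((Modules.pullback q₀).obj E))) :
    SameClass ((Modules.pushforward p).obj ((Modules.pullback q).obj E))
      ((Modules.pushforward q).obj ((Modules.pullback q).obj E)) := by
  subst hp₀ hq₀
  obtain ⟨hl₀, hr₀, h₀⟩ := h₀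
  have hφq := carriesLocalBases_pullbackToPushforward i q hE
  have hφp := hφq.of_preimage_eq hpq
  obtain ⟨θ⟩ := nonempty_pushforward_iso p q hpq _ (hφp.appLE_smul_eq_appLE_smul_kernel hi)
  obtain ⟨hkl, hl, hladd⟩ := hφp.exists_mk_pushforward_eq_add hp hl₀
  obtain ⟨hkr, hr, hradd⟩ := hφq.exists_mk_pushforward_eq_add hq hr₀
  refine ⟨hl, hr, ?_⟩
  rw [hladd, hradd, h₀, mk_eq_of_iso θ hkl hkr]

end Classes

namespace infinitesimalNbhd

variable {X S : Scheme.{u}} {f : X ⟶ S}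

theorem isFiniteLocallyFree_fst (hf : IsDifferentiallySmooth f) (k : ℕ) :
    IsFiniteLocallyFree (fst f k) :=
  .of_isFiniteProjective _ fun x => by
    obtain ⟨V, U, e, hV, hU, hx, h⟩ := hf x
    exact ⟨U, hx, hU, isAffineOpen_fst_preimage e hV hU k, isFiniteProjective_fst_app e hV hU h k⟩

theorem isFiniteLocallyFree_snd (hf : IsDifferentiallySmooth f) (k : ℕ) :
    IsFiniteLocallyFree (snd f k) :=
  .of_isFiniteProjective _ fun x => by
    obtain ⟨V, U, e, hV, hU, hx, h⟩ := hf x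
    exact ⟨U, hx, hU, fst_preimage_eq_snd_preimage f k U ▸ isAffineOpen_fst_preimage e hV hU k,
      isFiniteProjective_snd_app e hV hU h k⟩

end infinitesimalNbhd

open infinitesimalNbhd in
theorem theorem4p6_general {X S : Scheme.{u}} (f : X ⟶ S) (k : ℕ)
    (hf : ∀ n ≤ k, IsFiniteLocallyFree (fst f n) ∧ IsFiniteLocallyFree (snd f n))
    (E : X.Modules) (hE : IsLocallyFreeOfFiniteRank E) :
    ∃ (hl : IsLocallyFreeOfFiniteRank (jetLeft f k E))
      (hr : IsLocallyFreeOfFiniteRank (jetRight f k E)),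
      KGroup.mk (jetLeft f k E) hl = KGroup.mk (jetRight f k E) hr := by
  induction k with
  | zero =>
    have hr : IsLocallyFreeOfFiniteRank (jetRight f 0 E) :=
      (hf 0 le_rfl).2.isLocallyFreeOfFiniteRank_pushforward_pullback (fun _ => rfl) hE
    have hlr : jetLeft f 0 E = jetRight f 0 E := by rw [jetLeft, jetRight, fst_zero_eq_snd_zero]
    exact ⟨hlr ▸ hr, hr, by simp only [hlr]⟩
  | succ k ih =>
    obtain ⟨hp, hq⟩ := hf (k + 1) le_rfl
    exact KGroup.SameClass.pushforward_pullback (transition_fst f k) (transition_snd f k) hp hq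
      (fst_preimage_eq_snd_preimage f (k + 1)) (agreeOnKernel_transition f k) hE
      (ih fun n hn => hf n (Nat.le_succ_of_le hn))

end

theorem theorem4p6 {X S : Scheme.{u}} (f : X ⟶ S) (hf : IsDifferentiallySmooth f)
    (E : X.Modules) (hE : IsLocallyFreeOfFiniteRank E) (k : ℕ) (hk : 1 ≤ k) :
    ∃ (hl : IsLocallyFreeOfFiniteRank (jetLeft f k E))
      (hr : IsLocallyFreeOfFiniteRank (jetRight f k E)),
      KGroup.mk (jetLeft f k E) hl = KGroup.mk (jetRight f k E) hr :=
  theorem4p6_general f k (fun n _ => ⟨infinitesimalNbhd.isFiniteLocallyFree_fst hf n,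
    infinitesimalNbhd.isFiniteLocallyFree_snd hf n⟩) E hE
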